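/- Fix $T>0$. Let $\mathbb D$ be the vector space of c\`adl\`ag functions $x:[0,T]\to\mathbb R$ (right-continuous on $[0,T)$, with left limits on $(0,T]$). For $v:[0,T]\to\mathbb R$ let $\|v\|(T)=\sup\{|v(0)|+\sum_{i=1}^m|v(t_i)-v(t_{i-1})|\}$, the supremum being over all partitions $0=t_0<\dots<t_m=T$, and let $\mathbb V=\{v\in\mathbb D:\|v\|(T)<\infty\}$. For $v_n,v_0\in\mathbb V$ write $v_n\Rightarrow v_0$ if $\int_{[0,T]}f\,dv_n\to\int_{[0,T]}f\,dv_0$ for every continuous $f:[0,T]\to\mathbb R$, where $dv$ is the signed measure on $[0,T]$ with $dv(\{0\})=v(0)$ and $dv((s,t])=v(t)-v(s)$. For $x_n,x_0\in\mathbb D$ write $x_n\to_S x_0$ if for every $\varepsilon>0$ there are $v_{n,\varepsilon},v_{0,\varepsilon}\in\mathbb V$ with $\|x_n-v_{n,\varepsilon}\|_\infty\le\varepsilon$ for all $n$, $\|x_0-v_{0,\varepsilon}\|_\infty\le\varepsilon$, and $v_{n,\varepsilon}\Rightarrow v_{0,\varepsilon}$. Write $x_n\to^*_S x_0$ if every subsequence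 of $(x_n)$ has a further subsequence that $\to_S$-converges to $x_0$. The $S$ topology on $\mathbb D$ is the topology whose closed sets are the sets $F$ that contain all limits of $\to_S$-convergent sequences of elements of $F$. Let $\mathbb A$ be the set of continuous functions $A:[0,T]\to\mathbb R$ with $A(0)=0$ and $\|A\|(T)<\infty$. For $A_n,A_0\in\mathbb A$ write $A_n\to_\tau A_0$ if $\sup_{t}|A_n(t)-A_0(t)|\to0$ and $\sup_n\|A_n\|(T)<\infty$. A set $\mathcal A\subset\mathbb A$ is relatively $\tau$-compact if every sequence in $\mathcal A$ has a subsequence that $\tau$-converges to some element of $\mathbb A$. Let $\Sigma$ be the topology on $\mathbb D$ given by the seminorms $x\mapsto|x(T)|$ and $\rho_{\mathcal A}(x)=\sup_{A\in\mathcal A}\bigl|\int_0^T x\,dA\bigr|$, where $\mathcal A$ runs over the relatively $\tau$-compact subsets of $\mathbb A$. Then, for all sequences $(x_n)$ in $\mathbb D$ and all $x_0\in\mathbb D$, the following hold. 1. $x_n\to^*_S x_0$ if and only if $x_n(T)\to x_0(T)$ and $$\sup_{A\in\mathcal A}\Bigl|\int_0^T\bigl(x_n(u)-x_0(u)\bigr)\,dA(u)\Bigr|\to0$$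 for every relatively $\tau$-compact set $\mathcal A\subset\mathbb A$. 2. $x_n\to^*_S x_0$ if and only if $x_n\to x_0$ in the $S$ topology. 3. $x_n\to^*_S x_0$ if and only if $x_n\to x_0$ in the topology $\Sigma$. Moreover, $\Sigma$ makes $\mathbb D$ a locally convex topological vector space, and $S$ is finer than $\Sigma$ (every $\Sigma$-open set is $S$-open). -/

import Mathlib

open Set Filter Topology MeasureTheory
open scoped ENNReal

noncomputable section

/-! ### The time interval `[0,T]` -/

/-- The time interval `[0,T]`. -/
abbrev TimeInterval (T : ℝ) : Type := Icc (0 : ℝ) T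

namespace TimeInterval

instance (T : ℝ) : CompactIccSpace (TimeInterval T) :=
  ⟨fun {_ _} => isClosed_Icc.isCompact⟩

/-- The left end point `0` of `[0,T]`. -/
def left (T : ℝ) [hT : Fact (0 < T)] : TimeInterval T := ⟨0, le_rfl, hT.out.le⟩

/-- The right end point `T` of `[0,T]`. -/
def right (T : ℝ) [hT : Fact (0 < T)] : TimeInterval T := ⟨T, hT.out.le, le_rfl⟩

lemma isBot_left (T : ℝ) [Fact (0 < T)] : IsBot (left T) := fun t => t.2.1

lemma isTop_right (T : ℝ) [Fact (0 < T)] : IsTop (right T) := fun t => t.2.2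

end TimeInterval

open TimeInterval

/-! ### The Skorokhod space -/

/-- Càdlàg functions on `[0,T]`: right-continuous with left limits. Neighbourhoods are taken in
`[0,T]`, so right-continuity is void at `T`, and so is the existence of a left limit at `0`. -/
def IsCadlag {T : ℝ} (x : TimeInterval T → ℝ) : Prop :=
  (∀ t, ContinuousWithinAt x (Ici t) t) ∧ ∀ t, ∃ l : ℝ, Tendsto x (𝓝[<] t) (𝓝 l)

/-- The Skorokhod space `𝔻 = 𝔻([0,T])`, as a vector space of functions. (No use is made of the
topology of pointwise convergence that it carries as a subspace of a product.) -/
def Skorokhod (T : ℝ) : Submodule ℝ (TimeInterval T → ℝ) where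
  carrier := {x | IsCadlag x}
  zero_mem' := ⟨fun _ => continuousWithinAt_const, fun _ => ⟨0, tendsto_const_nhds⟩⟩
  add_mem' := by
    rintro x y ⟨hx, hx'⟩ ⟨hy, hy'⟩
    refine ⟨fun t => (hx t).add (hy t), fun t => ?_⟩
    obtain ⟨l, hl⟩ := hx' t
    obtain ⟨m, hm⟩ := hy' t
    exact ⟨l + m, hl.add hm⟩
  smul_mem' := by
    rintro c x ⟨hx, hx'⟩
    refine ⟨fun t => (hx t).const_smul c, fun t => ?_⟩
    obtain ⟨l, hl⟩ := hx' t
    exact ⟨c • l, hl.const_smul c⟩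

/-- The total variation `‖v‖(T) = sup { |v(0)| + ∑ |v(tᵢ) - v(tᵢ₋₁)| }` on `[0,T]`. -/
def totalVar {T : ℝ} [Fact (0 < T)] (v : TimeInterval T → ℝ) : ℝ≥0∞ :=
  ‖v (left T)‖ₑ + eVariationOn v univ

/-- The space `𝕍` of càdlàg functions of finite total variation. -/
def SkorokhodBV (T : ℝ) [Fact (0 < T)] : Type :=
  {v : Skorokhod T // totalVar (v : TimeInterval T → ℝ) < ∞}

/-- The space `𝔸` of continuous functions `A` of finite variation on `[0,T]` with `A(0) = 0`. -/
def Integrator (T : ℝ) [Fact (0 < T)] : Type :=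
  {A : C(TimeInterval T, ℝ) // A (left T) = 0 ∧ totalVar A < ∞}

lemma SkorokhodBV.boundedVariationOn {T : ℝ} [Fact (0 < T)] (v : SkorokhodBV T) :
    BoundedVariationOn (v.1 : TimeInterval T → ℝ) univ :=
  (lt_of_le_of_lt le_add_self v.2).ne

lemma Integrator.boundedVariationOn {T : ℝ} [Fact (0 < T)] (A : Integrator T) :
    BoundedVariationOn A.1 univ :=
  (lt_of_le_of_lt le_add_self A.2.2).ne

/-! ### Integrals -/

/-- The integral `∫_{[0,T]} f dv` for `v ∈ 𝕍`; the measure `dv` on `[0,T]` has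
`dv({0}) = v(0)` and `dv((s,t]) = v(t) - v(s)`. (Mathlib's Stieltjes measure of a function on
`[0,T]` gives no mass to `{0}`.) -/
def SkorokhodBV.integral {T : ℝ} [Fact (0 < T)] (v : SkorokhodBV T) (f : TimeInterval T → ℝ) : ℝ :=
  f (left T) * v.1.1 (left T) + ∫ᵛ t, f t ∂•v.boundedVariationOn.vectorMeasure

/-- The Stieltjes integral `∫_0^T x dA` for `A ∈ 𝔸`. -/
def Integrator.integral {T : ℝ} [Fact (0 < T)] (A : Integrator T) (x : TimeInterval T → ℝ) : ℝ :=
  ∫ᵛ t, x t ∂•A.boundedVariationOn.vectorMeasure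

/-! ### `S`-convergence and the `S` topology -/

/-- Weak-`*` convergence `v_n ⇒ v₀` in `𝕍`. -/
def SkorokhodBV.WeakStarConv {T : ℝ} [Fact (0 < T)] (v : ℕ → SkorokhodBV T) (v₀ : SkorokhodBV T) :
    Prop :=
  ∀ f : C(TimeInterval T, ℝ), Tendsto (fun n => (v n).integral f) atTop (𝓝 (v₀.integral f))

/-- `x_n →_S x₀`. -/
def SConv {T : ℝ} [Fact (0 < T)] (x : ℕ → Skorokhod T) (x₀ : Skorokhod T) : Prop :=
  ∀ ε : ℝ, 0 < ε → ∃ (v : ℕ → SkorokhodBV T) (v₀ : SkorokhodBV T),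
    (∀ n t, |(x n).1 t - (v n).1.1 t| ≤ ε) ∧ (∀ t, |x₀.1 t - v₀.1.1 t| ≤ ε) ∧
      SkorokhodBV.WeakStarConv v v₀

lemma SConv.comp {T : ℝ} [Fact (0 < T)] {x : ℕ → Skorokhod T} {x₀ : Skorokhod T}
    (h : SConv x x₀) {φ : ℕ → ℕ} (hφ : StrictMono φ) : SConv (x ∘ φ) x₀ := by
  intro ε hε
  obtain ⟨v, v₀, h₁, h₂, h₃⟩ := h ε hε
  exact ⟨v ∘ φ, v₀, fun n t => h₁ (φ n) t, h₂, fun f => (h₃ f).comp hφ.tendsto_atTop⟩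

/-- `x_n →*_S x₀`: every subsequence has a further subsequence that is `S`-convergent to `x₀`. -/
def SStarConv {T : ℝ} [Fact (0 < T)] (x : ℕ → Skorokhod T) (x₀ : Skorokhod T) : Prop :=
  ∀ φ : ℕ → ℕ, StrictMono φ → ∃ ψ : ℕ → ℕ, StrictMono ψ ∧ SConv (x ∘ φ ∘ ψ) x₀

/-- The `S` topology: `F` is closed iff limits of `S`-convergent sequences of elements of `F` remain
in `F`. -/
@[reducible] def sTopology (T : ℝ) [Fact (0 < T)] : TopologicalSpace (Skorokhod T) :=
  TopologicalSpace.ofClosed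
    {F | ∀ (x : ℕ → Skorokhod T) (x₀ : Skorokhod T), (∀ n, x n ∈ F) → SConv x x₀ → x₀ ∈ F}
    (fun _ _ hx _ => hx 0)
    (fun _ hG x x₀ hx h F hF => hG hF x x₀ (fun n => hx n F hF) h)
    (by
      intro F hF G hG x x₀ hx h
      by_cases hfr : ∃ᶠ n in atTop, x n ∈ F
      · obtain ⟨φ, hφ, hφF⟩ := extraction_of_frequently_atTop hfr
        exact Or.inl (hF _ _ hφF (h.comp hφ))
      · rw [not_frequently] at hfr
        obtain ⟨φ, hφ, hφG⟩ := extraction_of_eventually_atTop hfr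
        exact Or.inr (hG _ _ (fun n => (hx (φ n)).resolve_left (hφG n)) (h.comp hφ)))

/-! ### The mixed topology `τ` on `𝔸` -/

/-- `A_n →_τ A₀`: uniform convergence with bounded total variations. -/
def TauConv {T : ℝ} [Fact (0 < T)] (A : ℕ → Integrator T) (A₀ : Integrator T) : Prop :=
  TendstoUniformly (fun n t => (A n).1 t) (fun t => A₀.1 t) atTop ∧
    ⨆ n, totalVar (A n).1 < ∞

/-- Relatively `τ`-compact subsets of `𝔸`. -/
def IsRelTauCompact {T : ℝ} [Fact (0 < T)] (𝒜 : Set (Integrator T)) : Prop :=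
  ∀ A : ℕ → Integrator T, (∀ n, A n ∈ 𝒜) →
    ∃ (A₀ : Integrator T) (φ : ℕ → ℕ), StrictMono φ ∧ TauConv (A ∘ φ) A₀

/-! ### The locally convex topology `Σ`

The next lemmas show that the integrals are well defined and depend linearly on `x`, and that the
suprema in the definition of the seminorms are finite. -/

lemma IsCadlag.measurable {T : ℝ} [hT : Fact (0 < T)] {x : TimeInterval T → ℝ} (hx : IsCadlag x) :
    Measurable x := by
  have h0 : ∀ (n : ℕ) (k : ℤ), min T (max 0 (((k : ℝ) + 1) / (n + 1))) ∈ Icc (0 : ℝ) T :=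
    fun n k => ⟨le_min hT.out.le (le_max_left _ _), min_le_left _ _⟩
  let p : ℕ → ℤ → TimeInterval T := fun n k => ⟨_, h0 n k⟩
  let q : ℕ → TimeInterval T → ℤ := fun n t => ⌊(t : ℝ) * (n + 1)⌋
  have hq : ∀ n, Measurable (q n) := fun n =>
    Int.measurable_floor.comp (measurable_subtype_coe.mul_const _)
  refine measurable_of_tendsto_metrizable (f := fun n t => x (p n (q n t)))
    (fun n => (measurable_of_countable (fun k => x (p n k))).comp (hq n)) ?_
  rw [tendsto_pi_nhds]
  intro t
  have hge : ∀ n : ℕ, (t : ℝ) ≤ (((q n t : ℤ) : ℝ) + 1) / (n + 1) := fun n => by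
    rw [le_div_iff₀ (by positivity)]
    exact (Int.lt_floor_add_one _).le
  have hle : ∀ n : ℕ, (((q n t : ℤ) : ℝ) + 1) / (n + 1) ≤ t + 1 / ((n : ℝ) + 1) := fun n => by
    have hn : (0 : ℝ) < n + 1 := by positivity
    rw [div_le_iff₀ hn, add_mul, one_div, inv_mul_cancel₀ hn.ne']
    have := Int.floor_le ((t : ℝ) * (n + 1))
    simp only [q]
    linarith
  have hp : Tendsto (fun n => p n (q n t)) atTop (𝓝[≥] t) := by
    refine tendsto_nhdsWithin_iff.2 ⟨?_, Eventually.of_forall fun n => ?_⟩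
    · rw [tendsto_subtype_rng]
      refine tendsto_of_tendsto_of_tendsto_of_le_of_le (g := fun _ => (t : ℝ))
        (h := fun n : ℕ => (t : ℝ) + 1 / ((n : ℝ) + 1)) tendsto_const_nhds ?_ ?_ ?_
      · simpa using tendsto_const_nhds.add (tendsto_one_div_add_atTop_nhds_zero_nat (𝕜 := ℝ))
      · exact fun n => le_min t.2.2 (le_max_of_le_right (hge n))
      · refine fun n => (min_le_right _ _).trans (max_le ?_ (hle n))
        have := t.2.1
        positivity
    · change (t : ℝ) ≤ min T (max 0 ((((q n t : ℤ) : ℝ) + 1) / (n + 1)))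
      exact le_min t.2.2 (le_max_of_le_right (hge n))
  exact (hx.1 t).tendsto.comp hp

lemma IsCadlag.exists_bound {T : ℝ} {x : TimeInterval T → ℝ} (hx : IsCadlag x) :
    ∃ C : ℝ, ∀ t, ‖x t‖ ≤ C := by
  have hc : IsCompact (univ : Set (TimeInterval T)) := isCompact_univ
  suffices ∃ C : ℝ, ∀ t ∈ (univ : Set (TimeInterval T)), ‖x t‖ ≤ C by simpa using this
  refine hc.induction_on (p := fun s => ∃ C : ℝ, ∀ t ∈ s, ‖x t‖ ≤ C) ⟨0, by simp⟩
    (fun s u hsu ⟨C, hC⟩ => ⟨C, fun t ht => hC t (hsu ht)⟩)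
    (fun s u ⟨C, hC⟩ ⟨D, hD⟩ => ⟨max C D, fun t ht => ht.elim
      (fun h => (hC t h).trans (le_max_left _ _)) fun h => (hD t h).trans (le_max_right _ _)⟩) ?_
  intro t _
  obtain ⟨l, hl⟩ := hx.2 t
  have h₁ : ∀ᶠ s in 𝓝[<] t, ‖x s‖ ≤ max (‖l‖ + 1) (‖x t‖ + 1) := by
    filter_upwards [hl.norm.eventually_lt_const (lt_add_one ‖l‖)] with s hs
    exact hs.le.trans (le_max_left _ _)
  have h₂ : ∀ᶠ s in 𝓝[≥] t, ‖x s‖ ≤ max (‖l‖ + 1) (‖x t‖ + 1) := by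
    filter_upwards [(hx.1 t).norm.eventually_lt_const (lt_add_one ‖x t‖)] with s hs
    exact hs.le.trans (le_max_right _ _)
  refine ⟨{s | ‖x s‖ ≤ max (‖l‖ + 1) (‖x t‖ + 1)}, ?_, _, fun s hs => hs⟩
  rw [nhdsWithin_univ, ← nhdsLT_sup_nhdsGE]
  exact Filter.mem_sup.2 ⟨h₁, h₂⟩

/-- The Stieltjes measure of a right-continuous function of finite variation on `[0,T]` has total
mass at most the variation of the function. -/
lemma variation_vectorMeasure_le {T : ℝ} [Fact (0 < T)] {f : TimeInterval T → ℝ}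
    (hf : BoundedVariationOn f univ) (hc : ∀ t, ContinuousWithinAt f (Ici t) t) :
    hf.vectorMeasure.variation univ ≤ eVariationOn f univ := by
  set g : TimeInterval T → ℝ := variationOnFromTo f univ (left T) with hg
  have hgc : ∀ t, ContinuousWithinAt g (Ici t) t := fun t =>
    hf.continuousWithinAt_variationOnFromTo_Ici (hc t)
  let P : StieltjesFunction (TimeInterval T) := ⟨fun t => g t + f t, by
    rw [← monotoneOn_univ]
    exact variationOnFromTo.add_self_monotoneOn hf.locallyBoundedVariationOn (mem_univ _),
    fun t => (hgc t).add (hc t)⟩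
  let Q : StieltjesFunction (TimeInterval T) := ⟨fun t => g t - f t, by
    rw [← monotoneOn_univ]
    exact variationOnFromTo.sub_self_monotoneOn hf.locallyBoundedVariationOn (mem_univ _),
    fun t => (hgc t).sub (hc t)⟩
  have hU : (univ : Set (TimeInterval T)) = Icc (left T) (right T) :=
    (eq_univ_of_forall fun t => mem_Icc.2 ⟨isBot_left T t, isTop_right T t⟩).symm
  have hlL : ∀ h : TimeInterval T → ℝ, h.leftLim (left T) = h (left T) := fun h => by
    apply leftLim_eq_of_eq_bot
    rw [(show Iio (left T) = ∅ from eq_empty_of_forall_notMem fun t ht =>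
      absurd ht (not_lt.2 (isBot_left T t))), nhdsWithin_empty]
  have hrL : ∀ t, f.rightLim t = f t := fun t => (hc t).rightLim_eq
  have hT : left T ≤ right T := isBot_left T _
  have hPu : P.measure univ = ENNReal.ofReal (P (right T) - P (left T)) := by
    rw [hU, StieltjesFunction.measure_Icc, hlL]
  have hQu : Q.measure univ = ENNReal.ofReal (Q (right T) - Q (left T)) := by
    rw [hU, StieltjesFunction.measure_Icc, hlL]
  have : IsFiniteMeasure P.measure := ⟨by rw [hPu]; exact ENNReal.ofReal_lt_top⟩
  have : IsFiniteMeasure Q.measure := ⟨by rw [hQu]; exact ENNReal.ofReal_lt_top⟩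
  have key : (2 : ℝ) • hf.vectorMeasure = P.measure.toSignedMeasure - Q.measure.toSignedMeasure := by
    refine VectorMeasure.ext_of_generateFrom {s | ∃ u v, u ≤ v ∧ s = Ioc u v} ?_ ?_ ?_ ?_
    · rintro _ ⟨u, v, huv, rfl⟩
      have h₁ := P.mono huv
      have h₂ := Q.mono huv
      simp only [FunLike.coe_smul, FunLike.coe_sub, Pi.smul_apply, Pi.sub_apply,
        hf.vectorMeasure_Ioc huv, hrL, Measure.toSignedMeasure_apply_measurable measurableSet_Ioc,
        Measure.real, StieltjesFunction.measure_Ioc, ENNReal.toReal_ofReal (sub_nonneg.2 h₁),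
        ENNReal.toReal_ofReal (sub_nonneg.2 h₂), smul_eq_mul]
      simp only [P, Q]
      ring
    · rw [BorelSpace.measurable_eq (α := TimeInterval T), borel_eq_generateFrom_Ioc_le]
      congr 1
      ext s
      simp only [mem_ofPred_eq, eq_comm]
    · rintro _ ⟨a, b, -, rfl⟩ _ ⟨c, d, -, rfl⟩ hne
      rw [Ioc_inter_Ioc] at hne ⊢
      exact ⟨_, _, (nonempty_Ioc.1 hne).le, rfl⟩
    · have h₁ := P.mono hT
      have h₂ := Q.mono hT
      have h₃ : hf.vectorMeasure univ = f (right T) - f (left T) := by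
        rw [hU, hf.vectorMeasure_Icc hT, hrL, hlL]
      simp only [FunLike.coe_smul, FunLike.coe_sub, Pi.smul_apply, Pi.sub_apply, h₃,
        Measure.toSignedMeasure_apply_measurable MeasurableSet.univ, Measure.real, hPu, hQu,
        ENNReal.toReal_ofReal (sub_nonneg.2 h₁), ENNReal.toReal_ofReal (sub_nonneg.2 h₂),
        smul_eq_mul]
      simp only [P, Q]
      ring
  have h₁ := P.mono hT
  have h₂ := Q.mono hT
  have hle : ((2 : ℝ) • hf.vectorMeasure).variation univ ≤ 2 * eVariationOn f univ := by
    rw [key]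
    refine (VectorMeasure.variation_sub_le univ).trans ?_
    rw [Measure.variation_toSignedMeasure, Measure.variation_toSignedMeasure, Measure.add_apply,
      hPu, hQu, ← ENNReal.ofReal_add (sub_nonneg.2 h₁) (sub_nonneg.2 h₂)]
    have hgT : g (right T) = (eVariationOn f univ).toReal := by
      rw [hg, variationOnFromTo.eq_of_le _ _ hT, ← hU, inter_self]
    have hg0 : g (left T) = 0 := variationOnFromTo.self _ _ _
    have : P (right T) - P (left T) + (Q (right T) - Q (left T)) =
        2 * (eVariationOn f univ).toReal := by
      rw [← hgT]
      change g (right T) + f (right T) - (g (left T) + f (left T)) +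
        (g (right T) - f (right T) - (g (left T) - f (left T))) = _
      rw [hg0]
      ring
    rw [this, ENNReal.ofReal_mul (by norm_num), ENNReal.ofReal_toReal hf]
    simp
  rw [VectorMeasure.variation_smul, Measure.smul_apply] at hle
  have h2 : ‖(2 : ℝ)‖₊ • hf.vectorMeasure.variation univ = 2 * hf.vectorMeasure.variation univ := by
    rw [ENNReal.smul_def, smul_eq_mul]
    congr 1
    simp
  rw [h2] at hle
  exact (ENNReal.mul_le_mul_iff_right (by norm_num) (by norm_num)).1 hle

namespace Integrator

variable {T : ℝ} [Fact (0 < T)] (A : Integrator T)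

lemma variation_le : A.boundedVariationOn.vectorMeasure.variation univ ≤ totalVar A.1 :=
  (variation_vectorMeasure_le _ fun _ => A.1.continuous.continuousWithinAt).trans le_add_self

instance : IsFiniteMeasure A.boundedVariationOn.vectorMeasure.variation :=
  ⟨A.variation_le.trans_lt A.2.2⟩

lemma integrable (x : Skorokhod T) : A.boundedVariationOn.vectorMeasure.Integrable x.1 := by
  obtain ⟨C, hC⟩ := IsCadlag.exists_bound x.2
  exact Integrable.of_bound (IsCadlag.measurable x.2).aestronglyMeasurable C
    (Eventually.of_forall hC)

/-- The functional `x ↦ ∫_0^T x dA` on `𝔻`. -/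
def integralₗ : Skorokhod T →ₗ[ℝ] ℝ where
  toFun x := A.integral x.1
  map_add' x y := VectorMeasure.integral_add (A.integrable x) (A.integrable y)
  map_smul' c x := VectorMeasure.integral_smul x.1 _ _ c

lemma abs_integral_le {x : Skorokhod T} {C : ℝ} (hC : ∀ t, ‖x.1 t‖ ≤ C) :
    |A.integral x.1| ≤ C * (totalVar A.1).toReal := by
  have h := VectorMeasure.norm_integral_le_of_norm_le_const
    (μ := A.boundedVariationOn.vectorMeasure) (B := ContinuousLinearMap.lsmul ℝ ℝ)
    (f := x.1) (Eventually.of_forall hC)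
  have hC0 : 0 ≤ C := (norm_nonneg _).trans (hC (left T))
  refine h.trans ?_
  have h₁ : ‖(ContinuousLinearMap.lsmul ℝ ℝ : ℝ →L[ℝ] ℝ →L[ℝ] ℝ)‖ ≤ 1 :=
    ContinuousLinearMap.opNorm_lsmul_le
  refine mul_le_mul (mul_le_of_le_one_right hC0 h₁) ?_ ENNReal.toReal_nonneg hC0
  exact ENNReal.toReal_mono A.2.2.ne A.variation_le

end Integrator

lemma IsRelTauCompact.exists_bound {T : ℝ} [Fact (0 < T)] {𝒜 : Set (Integrator T)}
    (h𝒜 : IsRelTauCompact 𝒜) : ∃ C : ℝ, ∀ A ∈ 𝒜, (totalVar A.1).toReal ≤ C := by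
  by_contra! H
  choose A hA hlt using fun n : ℕ => H n
  obtain ⟨A₀, φ, hφ, -, hb⟩ := h𝒜 A hA
  obtain ⟨n, hn⟩ := exists_nat_gt (⨆ n, totalVar ((A ∘ φ) n).1).toReal
  have h₁ : (totalVar (A (φ n)).1).toReal ≤ (⨆ n, totalVar ((A ∘ φ) n).1).toReal :=
    ENNReal.toReal_mono hb.ne (le_iSup (fun n => totalVar ((A ∘ φ) n).1) n)
  have h₂ : (n : ℝ) ≤ φ n := by exact_mod_cast hφ.id_le n
  linarith [hlt (φ n)]

lemma IsRelTauCompact.bddAbove {T : ℝ} [Fact (0 < T)] {𝒜 : Set (Integrator T)}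
    (h𝒜 : IsRelTauCompact 𝒜) (x : Skorokhod T) :
    BddAbove (range fun A : 𝒜 => |A.1.integral x.1|) := by
  obtain ⟨C, hC⟩ := IsCadlag.exists_bound x.2
  obtain ⟨D, hD⟩ := h𝒜.exists_bound
  refine ⟨C * D, ?_⟩
  rintro _ ⟨A, rfl⟩
  exact (A.1.abs_integral_le hC).trans
    (mul_le_mul_of_nonneg_left (hD A.1 A.2) ((norm_nonneg _).trans (hC (left T))))

/-- The seminorm `ρ_T(x) = |x(T)|`. -/
def rhoEnd (T : ℝ) [Fact (0 < T)] : Seminorm ℝ (Skorokhod T) :=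
  Seminorm.of (fun x => |x.1 (right T)|) (fun _ _ => abs_add_le _ _) fun _ _ => abs_mul _ _

/-- The seminorm `ρ_𝒜(x) = sup_{A ∈ 𝒜} |∫_0^T x dA|`, for `𝒜` relatively `τ`-compact. -/
def rho {T : ℝ} [Fact (0 < T)] {𝒜 : Set (Integrator T)} (h𝒜 : IsRelTauCompact 𝒜) :
    Seminorm ℝ (Skorokhod T) :=
  Seminorm.of (fun x => ⨆ A : 𝒜, |A.1.integral x.1|)
    (fun x y => Real.iSup_le
      (fun A => by
        have h : A.1.integral (x + y).1 = A.1.integral x.1 + A.1.integral y.1 :=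
          map_add (Integrator.integralₗ A.1) x y
        rw [h]
        exact (abs_add_le _ _).trans (add_le_add (le_ciSup (h𝒜.bddAbove x) A)
          (le_ciSup (h𝒜.bddAbove y) A)))
      (add_nonneg (Real.iSup_nonneg fun _ => abs_nonneg _) (Real.iSup_nonneg fun _ => abs_nonneg _)))
    (fun c x => by
      have h : ∀ A : 𝒜, A.1.integral (c • x).1 = c * A.1.integral x.1 := fun A =>
        map_smul (Integrator.integralₗ A.1) c x
      simp only [h, abs_mul]
      exact (Real.mul_iSup_of_nonneg (abs_nonneg c) _).symm)

/-- The seminorms `ρ_T` and `ρ_𝒜`, where `𝒜` runs over the relatively `τ`-compact sets. -/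
def sigmaFamily (T : ℝ) [Fact (0 < T)] :
    SeminormFamily ℝ (Skorokhod T) (Option {𝒜 : Set (Integrator T) // IsRelTauCompact 𝒜})
  | none => rhoEnd T
  | some 𝒜 => rho 𝒜.2

/-- The topology `Σ` on `𝔻` given by the seminorms `ρ_T` and `ρ_𝒜`. -/
@[reducible] def sigmaTopology (T : ℝ) [Fact (0 < T)] : TopologicalSpace (Skorokhod T) :=
  (sigmaFamily T).moduleFilterBasis.topology

/-- Convergence of sequences in a given topology `t`. -/
abbrev TendstoIn {X : Type*} (t : TopologicalSpace X) (x : ℕ → X) (x₀ : X) : Prop :=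
  Tendsto x atTop (@nhds X t x₀)

/-- The topology `t` makes the real vector space `E` a locally convex topological vector space. -/
def IsLocallyConvexTopology {E : Type*} [AddCommGroup E] [Module ℝ E] (t : TopologicalSpace E) :
    Prop :=
  @IsTopologicalAddGroup E t _ ∧ @ContinuousSMul ℝ E _ _ t ∧ @LocallyConvexSpace ℝ E _ _ _ _ t

end

/-!
Everything follows from one equivalence: `x_n →*_S x₀` holds if and only if `x_n(T) → x₀(T)` and
`∫ x_n dA → ∫ x₀ dA` uniformly over each relatively `τ`-compact set of integrators
(`sStarConv_iff_sigmaConv`). The second condition is convergence for the seminorms of `Σ`. Hence a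
`Σ`-closed set contains the limits of its `S`-convergent sequences, that is, it is `S`-closed. Since
`→*_S` implies convergence in `S`, hence in `Σ`, all modes of convergence coincide.

*From `S` to `Σ`* (`SConv.sigmaConv`). Integration by parts gives `∫ v dA = v(T) A(T) - ∫ A dv`.
If `v_n ⇒ v₀`, the functionals `dv_n` on `C([0,T])` are bounded by the Banach–Steinhaus theorem, so
`∫ v_n dA_n → ∫ v₀ dA₀` whenever `A_n →_τ A₀`; the bound on the total variations of the `A_n`
extends this to `x_n →_S x₀` by uniform approximation. On relatively compact sets of integrators
this joint continuity becomes uniform convergence.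

*From `Σ` to `S`* (`SigmaConv.exists_subseq_sConv`). The times at which `x` has moved by `ε` since
the preceding such time define a step function within `ε` of `x`. Let `V` be the sum of its
absolute jumps, starting with `|x(0)|`. Integrating `x` against a combination of differences of
steep ramps just after consecutive times, with coefficients `± ε / (ε + V)`, gives at least `ε / 4`,
while the combination has total variation at most `2` and supremum norm at most `2 ε / V`
(`exists_approx_and_witness`). If the numbers `V` were unbounded along `x_n`, these integrators
would tend to `0` for `τ`, and uniform convergence of the integrals over them would fail. So the
`x_n` have step approximations of bounded variation (`SigmaConv.exists_bounded_approx`). By weak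
compactness of sets of finite measures of bounded mass, a subsequence of these approximations
converges weakly for all `ε = 1 / (k + 1)` at once, and testing with ramps shows that the limits are
within `ε` of `x₀` (`SigmaConv.abs_sub_le`).

Functions of finite variation are handled throughout as differences of distribution functions of
finite measures (`distFun`), which turns Stieltjes integrals into differences of Lebesgue integrals.
-/

open TimeInterval

noncomputable section

/-! ### Total variation -/

section Variation

lemma eVariationOn_add_le {α : Type*} [LinearOrder α] (f g : α → ℝ) (s : Set α) :
    eVariationOn (f + g) s ≤ eVariationOn f s + eVariationOn g s := by
  refine iSup_le fun p => ?_
  calc ∑ i ∈ Finset.range p.1, edist ((f + g) (p.2.1 (i + 1))) ((f + g) (p.2.1 i))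
      ≤ ∑ i ∈ Finset.range p.1, (edist (f (p.2.1 (i + 1))) (f (p.2.1 i)) +
          edist (g (p.2.1 (i + 1))) (g (p.2.1 i))) :=
        Finset.sum_le_sum fun i _ => edist_add_add_le _ _ _ _
    _ ≤ eVariationOn f s + eVariationOn g s := by
        rw [Finset.sum_add_distrib]
        exact add_le_add (eVariationOn.sum_le p.2.2.1 p.2.2.2)
          (eVariationOn.sum_le p.2.2.1 p.2.2.2)

lemma eVariationOn_const_smul_le {α : Type*} [LinearOrder α] (c : ℝ) (f : α → ℝ) (s : Set α) :
    eVariationOn (c • f) s ≤ ‖c‖ₑ * eVariationOn f s := by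
  refine iSup_le fun p => ?_
  calc ∑ i ∈ Finset.range p.1, edist ((c • f) (p.2.1 (i + 1))) ((c • f) (p.2.1 i))
      = ‖c‖ₑ * ∑ i ∈ Finset.range p.1, edist (f (p.2.1 (i + 1))) (f (p.2.1 i)) := by
        rw [Finset.mul_sum]
        refine Finset.sum_congr rfl fun i _ => ?_
        simp only [Pi.smul_apply, edist_smul₀]
        rfl
    _ ≤ _ := by
        gcongr
        exact eVariationOn.sum_le p.2.2.1 p.2.2.2

variable {T : ℝ} [Fact (0 < T)]

lemma totalVar_zero : totalVar (0 : TimeInterval T → ℝ) = 0 := by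
  have : eVariationOn (0 : TimeInterval T → ℝ) univ = 0 :=
    eVariationOn.constant_on (by rintro _ ⟨a, -, rfl⟩ _ ⟨b, -, rfl⟩; rfl)
  simp [totalVar, this]

lemma totalVar_add_le (f g : TimeInterval T → ℝ) :
    totalVar (f + g) ≤ totalVar f + totalVar g := by
  unfold totalVar
  calc ‖(f + g) (left T)‖ₑ + eVariationOn (f + g) univ
      ≤ (‖f (left T)‖ₑ + ‖g (left T)‖ₑ) + (eVariationOn f univ + eVariationOn g univ) :=
        add_le_add (enorm_add_le _ _) (eVariationOn_add_le _ _ _)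
    _ = _ := add_add_add_comm _ _ _ _

lemma totalVar_const_smul_le (c : ℝ) (f : TimeInterval T → ℝ) :
    totalVar (c • f) ≤ ‖c‖ₑ * totalVar f := by
  unfold totalVar
  rw [mul_add]
  refine add_le_add ?_ (eVariationOn_const_smul_le _ _ _)
  simp [enorm_mul]

lemma totalVar_sub_le (f g : TimeInterval T → ℝ) :
    totalVar (f - g) ≤ totalVar f + totalVar g := by
  have h := totalVar_const_smul_le (-1) g
  rw [show f - g = f + (-1 : ℝ) • g by ext; simp; ring]
  refine (totalVar_add_le _ _).trans (add_le_add le_rfl (h.trans ?_))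
  simp

lemma totalVar_of_monotone {f : TimeInterval T → ℝ} (hf : Monotone f) (h0 : 0 ≤ f (left T)) :
    totalVar f = ENNReal.ofReal (f (right T)) := by
  have h := (hf.monotoneOn univ).eVariationOn_eq (a := left T) (b := right T) (mem_univ _)
    (mem_univ _)
  have hU : (univ : Set (TimeInterval T)) ∩ Icc (left T) (right T) = univ := by
    rw [univ_inter]
    exact eq_univ_of_forall fun t => mem_Icc.2 ⟨isBot_left T t, isTop_right T t⟩
  rw [hU] at h
  rw [totalVar, h, Real.enorm_of_nonneg h0,
    ← ENNReal.ofReal_add h0 (sub_nonneg.2 (hf (isBot_left T _)))]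
  ring_nf

end Variation

/-! ### Distribution functions and integration by parts -/

section DistFun

variable {T : ℝ}

/-- The distribution function `t ↦ μ [0,t]` of a measure on `[0,T]`. -/
def distFun (μ : Measure (TimeInterval T)) (t : TimeInterval T) : ℝ := μ.real (Iic t)

lemma distFun_nonneg (μ : Measure (TimeInterval T)) (t : TimeInterval T) : 0 ≤ distFun μ t :=
  measureReal_nonneg

lemma distFun_mono (μ : Measure (TimeInterval T)) [IsFiniteMeasure μ] : Monotone (distFun μ) :=
  fun _ _ h => measureReal_mono (Iic_subset_Iic.2 h)

lemma distFun_right [Fact (0 < T)] (μ : Measure (TimeInterval T)) :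
    distFun μ (right T) = μ.real univ := by
  rw [distFun, show Iic (right T) = univ from eq_univ_of_forall fun t => isTop_right T t]

lemma distFun_add (μ ν : Measure (TimeInterval T)) [IsFiniteMeasure μ] [IsFiniteMeasure ν] :
    distFun (μ + ν) = distFun μ + distFun ν := by
  ext t
  exact measureReal_add_apply

lemma distFun_nnreal_smul (c : NNReal) (μ : Measure (TimeInterval T)) (t : TimeInterval T) :
    distFun (c • μ) t = c * distFun μ t :=
  measureReal_nnreal_smul_apply c

lemma distFun_dirac (a t : TimeInterval T) :
    distFun (Measure.dirac a) t = if a ≤ t then 1 else 0 := by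
  simp [distFun, Measure.real, indicator_apply]
  split_ifs <;> simp

lemma isCadlag_distFun (μ : Measure (TimeInterval T)) [IsFiniteMeasure μ] :
    IsCadlag (distFun μ) := by
  refine ⟨fun t => ?_, fun t => ⟨_, (distFun_mono μ).tendsto_leftLim t⟩⟩
  have h : distFun μ = fun t => ∫ s, (Iic t).indicator (fun _ => (1 : ℝ)) s ∂μ := by
    ext t
    rw [integral_indicator_const _ measurableSet_Iic, distFun, smul_eq_mul, mul_one]
  rw [h]
  refine continuousWithinAt_of_dominated (bound := fun _ => 1)
    (Eventually.of_forall fun u =>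
      (measurable_const.indicator measurableSet_Iic).aestronglyMeasurable)
    (Eventually.of_forall fun u => Eventually.of_forall fun s => ?_) (integrable_const _)
    (Eventually.of_forall fun s => ?_)
  · by_cases hs : s ∈ Iic u <;> simp [hs]
  · rcases le_or_gt s t with hst | hst
    · refine continuousWithinAt_const.congr (f := fun _ => (1 : ℝ)) (fun u hu => ?_) ?_
      · exact indicator_of_mem (show s ∈ Iic u from hst.trans hu) _
      · exact indicator_of_mem (show s ∈ Iic t from hst) _
    · refine ContinuousAt.continuousWithinAt ?_
      refine continuousAt_const.congr (f := fun _ => (0 : ℝ)) ?_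
      filter_upwards [Iio_mem_nhds hst] with u hu
      exact (indicator_of_notMem (show s ∉ Iic u from fun h : s ≤ u => not_lt_of_ge h hu) _).symm

lemma measurableSpace_eq_generateFrom_Ioc :
    (Subtype.instMeasurableSpace : MeasurableSpace (TimeInterval T)) =
      MeasurableSpace.generateFrom {s | ∃ u v, u ≤ v ∧ s = Ioc u v} := by
  rw [BorelSpace.measurable_eq (α := TimeInterval T), borel_eq_generateFrom_Ioc_le]
  congr 1
  ext s
  simp only [mem_ofPred_eq, eq_comm]

lemma integrable_of_bound {x : TimeInterval T → ℝ} (hx : Measurable x)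
    (hb : ∃ C : ℝ, ∀ t, ‖x t‖ ≤ C) (μ : Measure (TimeInterval T)) [IsFiniteMeasure μ] :
    Integrable x μ := by
  obtain ⟨C, hC⟩ := hb
  exact Integrable.of_bound hx.aestronglyMeasurable C (Eventually.of_forall hC)

lemma bounded_of_continuous (f : C(TimeInterval T, ℝ)) : ∃ C : ℝ, ∀ t, ‖f t‖ ≤ C :=
  ⟨‖f‖, f.norm_coe_le_norm⟩

/-- Fubini for distribution functions. -/
lemma integral_distFun (μ α : Measure (TimeInterval T)) [IsFiniteMeasure μ] [IsFiniteMeasure α] :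
    ∫ t, distFun μ t ∂α = ∫ s, α.real (Ici s) ∂μ := by
  have hm : MeasurableSet {p : TimeInterval T × TimeInterval T | p.2 ≤ p.1} :=
    measurableSet_le measurable_snd measurable_fst
  have h1 : ∀ t, distFun μ t =
      ∫ s, ({p : TimeInterval T × TimeInterval T | p.2 ≤ p.1}.indicator (fun _ => (1 : ℝ)))
        (t, s) ∂μ := fun t => by
    rw [distFun, ← integral_indicator_one measurableSet_Iic]
    rfl
  have h2 : ∀ s, α.real (Ici s) =
      ∫ t, ({p : TimeInterval T × TimeInterval T | p.2 ≤ p.1}.indicator (fun _ => (1 : ℝ)))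
        (t, s) ∂α := fun s => by
    rw [← integral_indicator_one measurableSet_Ici]
    rfl
  simp_rw [h1, h2]
  exact integral_integral_swap ((integrable_const 1).indicator hm)

variable [Fact (0 < T)]

lemma totalVar_distFun_sub_lt_top (μ ν : Measure (TimeInterval T)) [IsFiniteMeasure μ]
    [IsFiniteMeasure ν] : totalVar (distFun μ - distFun ν) < ∞ := by
  refine (totalVar_sub_le _ _).trans_lt (ENNReal.add_lt_top.2 ⟨?_, ?_⟩)
  · rw [totalVar_of_monotone (distFun_mono μ) (distFun_nonneg _ _)]
    exact ENNReal.ofReal_lt_top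
  · rw [totalVar_of_monotone (distFun_mono ν) (distFun_nonneg _ _)]
    exact ENNReal.ofReal_lt_top

/-- The element `t ↦ μ [0,t] - ν [0,t]` of `𝕍`. -/
def SkorokhodBV.ofMeasures (μ ν : Measure (TimeInterval T)) [IsFiniteMeasure μ]
    [IsFiniteMeasure ν] : SkorokhodBV T :=
  ⟨⟨distFun μ - distFun ν,
    (Skorokhod T).sub_mem (isCadlag_distFun μ) (isCadlag_distFun ν)⟩,
    totalVar_distFun_sub_lt_top μ ν⟩

lemma leftLim_left (f : TimeInterval T → ℝ) : f.leftLim (left T) = f (left T) := by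
  apply leftLim_eq_of_eq_bot
  rw [(show Iio (left T) = ∅ from eq_empty_of_forall_notMem fun t ht =>
    absurd ht (not_lt.2 (isBot_left T t))), nhdsWithin_empty]

lemma univ_eq_Icc : (univ : Set (TimeInterval T)) = Icc (left T) (right T) :=
  (eq_univ_of_forall fun t => mem_Icc.2 ⟨isBot_left T t, isTop_right T t⟩).symm

/-- The Stieltjes measure of a difference of distribution functions is the difference of the two
measures, up to the mass at `0`, which the Stieltjes measure does not see. -/
lemma vectorMeasure_eq_sub {f : TimeInterval T → ℝ} (hf : BoundedVariationOn f univ)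
    {μ ν : Measure (TimeInterval T)} [IsFiniteMeasure μ] [IsFiniteMeasure ν]
    (h : ∀ t, f t = distFun μ t - distFun ν t) :
    hf.vectorMeasure =
      μ.toSignedMeasure - ν.toSignedMeasure - VectorMeasure.dirac (left T) (f (left T)) := by
  have hrL : ∀ t, f.rightLim t = f t := fun t => by
    have hc : ContinuousWithinAt f (Ici t) t := by
      rw [show f = distFun μ - distFun ν from funext h]
      exact ((isCadlag_distFun μ).1 t).sub ((isCadlag_distFun ν).1 t)
    exact hc.rightLim_eq
  refine VectorMeasure.ext_of_generateFrom {s | ∃ u v, u ≤ v ∧ s = Ioc u v} ?_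
    measurableSpace_eq_generateFrom_Ioc ?_ ?_
  · rintro _ ⟨u, v, huv, rfl⟩
    have hIoc : ∀ (κ : Measure (TimeInterval T)) [IsFiniteMeasure κ],
        κ.real (Ioc u v) = distFun κ v - distFun κ u := fun κ _ => by
      rw [distFun, distFun, ← measureReal_sdiff (Iic_subset_Iic.2 huv) measurableSet_Iic]
      congr 1
      ext s
      simp [and_comm]
    have hd : VectorMeasure.dirac (left T) (f (left T)) (Ioc u v) = 0 := by
      rw [VectorMeasure.dirac_apply_of_notMem]
      exact fun h => absurd h.1 (not_lt.2 (isBot_left T u))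
    simp only [FunLike.coe_sub, Pi.sub_apply, hf.vectorMeasure_Ioc huv, hrL, hd,
      Measure.toSignedMeasure_apply_measurable measurableSet_Ioc, hIoc]
    rw [h v, h u]
    ring
  · rintro _ ⟨a, b, -, rfl⟩ _ ⟨c, d, -, rfl⟩ hne
    rw [Ioc_inter_Ioc] at hne ⊢
    exact ⟨_, _, (nonempty_Ioc.1 hne).le, rfl⟩
  · have h₃ : hf.vectorMeasure univ = f (right T) - f (left T) := by
      rw [univ_eq_Icc, hf.vectorMeasure_Icc (isBot_left T _), hrL, leftLim_left]
    have hd : VectorMeasure.dirac (left T) (f (left T)) univ = f (left T) :=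
      VectorMeasure.dirac_apply_of_mem MeasurableSet.univ (mem_univ _)
    simp only [FunLike.coe_sub, Pi.sub_apply, h₃, hd,
      Measure.toSignedMeasure_apply_measurable MeasurableSet.univ]
    rw [h (right T), distFun_right, distFun_right]

lemma integral_vectorMeasure_eq_sub {f : TimeInterval T → ℝ} (hf : BoundedVariationOn f univ)
    {μ ν : Measure (TimeInterval T)} [IsFiniteMeasure μ] [IsFiniteMeasure ν]
    (h : ∀ t, f t = distFun μ t - distFun ν t) {x : TimeInterval T → ℝ} (hx : Measurable x)
    (hb : ∃ C : ℝ, ∀ t, ‖x t‖ ≤ C) :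
    x (left T) * f (left T) + ∫ᵛ t, x t ∂•hf.vectorMeasure = ∫ t, x t ∂μ - ∫ t, x t ∂ν := by
  have hl : (ContinuousLinearMap.lsmul ℝ ℝ : ℝ →L[ℝ] ℝ →L[ℝ] ℝ) =
      (ContinuousLinearMap.lsmul ℝ ℝ : ℝ →L[ℝ] ℝ →L[ℝ] ℝ).flip := by
    ext; simp
  have hi : ∀ (κ : Measure (TimeInterval T)) [IsFiniteMeasure κ],
      κ.toSignedMeasure.Integrable x := fun κ _ => by
    rw [VectorMeasure.Integrable, Measure.variation_toSignedMeasure]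
    exact integrable_of_bound hx hb κ
  have hd : (VectorMeasure.dirac (left T) (f (left T))).Integrable x := by
    rw [VectorMeasure.Integrable, VectorMeasure.variation_dirac]
    have : IsFiniteMeasure (‖f (left T)‖ₑ • Measure.dirac (left T)) :=
      inferInstanceAs (IsFiniteMeasure (‖f (left T)‖₊ • Measure.dirac (left T)))
    exact integrable_of_bound hx hb _
  rw [vectorMeasure_eq_sub hf h,
    VectorMeasure.integral_sub_vectorMeasure ((hi μ).sub_vectorMeasure (hi ν)) hd,
    VectorMeasure.integral_sub_vectorMeasure (hi μ) (hi ν), VectorMeasure.integral_dirac, hl,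
    VectorMeasure.integral_toSignedMeasure, VectorMeasure.integral_toSignedMeasure]
  simp only [ContinuousLinearMap.flip_apply, ContinuousLinearMap.lsmul_apply, smul_eq_mul]
  ring

lemma SkorokhodBV.integral_eq_sub (v : SkorokhodBV T) {μ ν : Measure (TimeInterval T)}
    [IsFiniteMeasure μ] [IsFiniteMeasure ν] (h : ∀ t, v.1.1 t = distFun μ t - distFun ν t)
    (f : C(TimeInterval T, ℝ)) : v.integral f = ∫ t, f t ∂μ - ∫ t, f t ∂ν :=
  integral_vectorMeasure_eq_sub v.boundedVariationOn h f.continuous.measurable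
    (bounded_of_continuous f)

lemma Integrator.integral_eq_sub (A : Integrator T) {μ ν : Measure (TimeInterval T)}
    [IsFiniteMeasure μ] [IsFiniteMeasure ν] (h : ∀ t, A.1 t = distFun μ t - distFun ν t)
    (x : Skorokhod T) : A.integral x.1 = ∫ t, x.1 t ∂μ - ∫ t, x.1 t ∂ν := by
  have := integral_vectorMeasure_eq_sub A.boundedVariationOn h (IsCadlag.measurable x.2)
    (IsCadlag.exists_bound x.2)
  rwa [A.2.1, mul_zero, zero_add] at this

lemma exists_eq_distFun {f : TimeInterval T → ℝ} (hf : Monotone f)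
    (hc : ∀ t, ContinuousWithinAt f (Ici t) t) (h0 : 0 ≤ f (left T)) :
    ∃ μ : Measure (TimeInterval T), IsFiniteMeasure μ ∧ ∀ t, f t = distFun μ t := by
  let R : StieltjesFunction (TimeInterval T) := ⟨f, hf, hc⟩
  have hIic : ∀ t : TimeInterval T, R.measure (Iic t) = ENNReal.ofReal (f t - f (left T)) :=
    fun t => by
      rw [show Iic t = Icc (left T) t from
        ext fun s => ⟨fun h => ⟨isBot_left T s, h⟩, fun h => h.2⟩,
        StieltjesFunction.measure_Icc, leftLim_left]
  have hfin : IsFiniteMeasure R.measure := ⟨by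
    rw [show univ = Iic (right T) from (eq_univ_of_forall fun t => isTop_right T t).symm, hIic]
    exact ENNReal.ofReal_lt_top⟩
  -- the Stieltjes measure gives no mass to the left end point
  refine ⟨R.measure + (f (left T)).toNNReal • Measure.dirac (left T), inferInstance, fun t => ?_⟩
  rw [distFun_add, Pi.add_apply, distFun_nnreal_smul, distFun_dirac, if_pos (isBot_left T t),
    distFun, Measure.real, hIic, ENNReal.toReal_ofReal (sub_nonneg.2 (hf (isBot_left T t))),
    Real.coe_toNNReal _ h0]
  ring

/-- Jordan decomposition: a right-continuous function of finite variation is a difference of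
distribution functions of finite measures. -/
lemma exists_eq_distFun_sub {f : TimeInterval T → ℝ} (hf : BoundedVariationOn f univ)
    (hc : ∀ t, ContinuousWithinAt f (Ici t) t) :
    ∃ μ ν : Measure (TimeInterval T), IsFiniteMeasure μ ∧ IsFiniteMeasure ν ∧
      ∀ t, f t = distFun μ t - distFun ν t := by
  set g : TimeInterval T → ℝ := variationOnFromTo f univ (left T) with hg
  have hgc : ∀ t, ContinuousWithinAt g (Ici t) t := fun t =>
    hf.continuousWithinAt_variationOnFromTo_Ici (hc t)
  have hg0 : g (left T) = 0 := variationOnFromTo.self _ _ _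
  have hgm : Monotone g := monotoneOn_univ.1
    (variationOnFromTo.monotoneOn hf.locallyBoundedVariationOn (mem_univ _))
  have hgf : Monotone fun t => g t - f t := monotoneOn_univ.1
    (variationOnFromTo.sub_self_monotoneOn hf.locallyBoundedVariationOn (mem_univ _))
  -- the constant `|f 0|` makes both functions nonnegative at the left end point
  obtain ⟨μ, hμ, hμ'⟩ := exists_eq_distFun (f := fun t => g t + |f (left T)|)
    (hgm.add_const _) (fun t => (hgc t).add continuousWithinAt_const) (by simp [hg0])
  obtain ⟨ν, hν, hν'⟩ := exists_eq_distFun (f := fun t => g t - f t + |f (left T)|)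
    (hgf.add_const _) (fun t => ((hgc t).sub (hc t)).add continuousWithinAt_const)
    (by simpa [hg0] using le_abs_self (f (left T)))
  exact ⟨μ, ν, hμ, hν, fun t => by rw [← hμ', ← hν']; ring⟩

lemma SkorokhodBV.exists_measures (v : SkorokhodBV T) :
    ∃ μ ν : Measure (TimeInterval T), IsFiniteMeasure μ ∧ IsFiniteMeasure ν ∧
      ∀ t, v.1.1 t = distFun μ t - distFun ν t :=
  exists_eq_distFun_sub v.boundedVariationOn v.1.2.1

lemma Integrator.exists_measures (A : Integrator T) :
    ∃ μ ν : Measure (TimeInterval T), IsFiniteMeasure μ ∧ IsFiniteMeasure ν ∧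
      ∀ t, A.1 t = distFun μ t - distFun ν t :=
  exists_eq_distFun_sub A.boundedVariationOn fun _ => A.1.continuous.continuousWithinAt

/-- Integration by parts, `∫ v dA = v(T) A(T) - ∫ A dv`. Continuity of `A` excludes a contribution
of common jumps, and `A(0) = 0` makes the mass of `dv` at `0` harmless. -/
lemma Integrator.integral_skorokhodBV (A : Integrator T) (v : SkorokhodBV T) :
    A.integral v.1.1 = v.1.1 (right T) * A.1 (right T) - v.integral A.1 := by
  obtain ⟨μ, ν, _, _, hv⟩ := v.exists_measures
  obtain ⟨α, β, _, _, hA⟩ := A.exists_measures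
  have hatom : ∀ s, α.real {s} = β.real {s} := fun s => by
    have h := A.boundedVariationOn.vectorMeasure_singleton (a := s)
    rw [A.1.continuous.continuousAt.continuousWithinAt.rightLim_eq,
      (show (A.1 : TimeInterval T → ℝ).leftLim s = A.1 s from
        (A.1.continuous.continuousAt.continuousWithinAt).leftLim_eq), sub_self,
      vectorMeasure_eq_sub A.boundedVariationOn hA, A.2.1] at h
    simp only [FunLike.coe_sub, Pi.sub_apply,
      Measure.toSignedMeasure_apply_measurable (measurableSet_singleton s)] at h
    simp at h
    linarith
  have hIci : ∀ s, α.real (Ici s) - β.real (Ici s) = A.1 (right T) - A.1 s := fun s => by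
    have h : ∀ (κ : Measure (TimeInterval T)) [IsFiniteMeasure κ],
        κ.real (Ici s) = κ.real univ - distFun κ s + κ.real {s} := fun κ _ => by
      have h1 : κ.real (Iic s) + κ.real (Ioi s) = κ.real univ := by
        rw [← measureReal_union (Iic_disjoint_Ioi le_rfl) measurableSet_Ioi, Iic_union_Ioi]
      have h2 : κ.real (Ici s) = κ.real {s} + κ.real (Ioi s) := by
        rw [← measureReal_union (by simp) measurableSet_Ioi, singleton_union, Ioi_insert]
      rw [distFun]
      linarith
    rw [h α, h β, hatom, hA, hA, distFun_right, distFun_right]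
    ring
  have hanti : ∀ (κ μ : Measure (TimeInterval T)) [IsFiniteMeasure κ] [IsFiniteMeasure μ],
      Integrable (fun s => κ.real (Ici s)) μ := fun κ μ _ _ => by
    have ha : Antitone fun s => κ.real (Ici s) := fun a b h =>
      measureReal_mono (Ici_subset_Ici.2 h)
    refine integrable_of_bound ha.measurable ⟨κ.real univ, fun s => ?_⟩ μ
    rw [Real.norm_of_nonneg measureReal_nonneg]
    exact measureReal_mono (subset_univ _)
  have hdi : ∀ (κ μ : Measure (TimeInterval T)) [IsFiniteMeasure κ] [IsFiniteMeasure μ],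
      Integrable (distFun κ) μ := fun κ μ _ _ =>
    integrable_of_bound (isCadlag_distFun κ).measurable (isCadlag_distFun κ).exists_bound μ
  have hAi : ∀ (μ : Measure (TimeInterval T)) [IsFiniteMeasure μ], Integrable (A.1) μ :=
    fun μ _ => integrable_of_bound A.1.continuous.measurable (bounded_of_continuous A.1) μ
  have key : ∀ (κ : Measure (TimeInterval T)) [IsFiniteMeasure κ],
      ∫ t, distFun κ t ∂α - ∫ t, distFun κ t ∂β =
        A.1 (right T) * κ.real univ - ∫ t, A.1 t ∂κ := fun κ _ => by
    rw [integral_distFun, integral_distFun, ← integral_sub (hanti α κ) (hanti β κ)]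
    simp_rw [hIci]
    rw [integral_sub (integrable_const _) (hAi κ)]
    simp [mul_comm]
  rw [A.integral_eq_sub hA, v.integral_eq_sub hv, hv (right T), distFun_right, distFun_right]
  simp_rw [hv]
  rw [integral_sub (hdi μ α) (hdi ν α), integral_sub (hdi μ β) (hdi ν β)]
  linarith [key μ, key ν]

end DistFun

/-! ### The bilinear pairing of integrators and càdlàg functions -/

section Bilinear

variable {T : ℝ} [Fact (0 < T)]

lemma Integrator.integral_sub (A : Integrator T) (x y : Skorokhod T) :
    A.integral (x - y).1 = A.integral x.1 - A.integral y.1 :=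
  map_sub A.integralₗ x y

/-- The vector space `𝔸`. -/
def integratorSubmodule (T : ℝ) [Fact (0 < T)] : Submodule ℝ C(TimeInterval T, ℝ) where
  carrier := {A | A (left T) = 0 ∧ totalVar A < ∞}
  zero_mem' := ⟨rfl, by rw [ContinuousMap.coe_zero, totalVar_zero]; exact ENNReal.zero_lt_top⟩
  add_mem' := by
    rintro A B ⟨hA, hA'⟩ ⟨hB, hB'⟩
    refine ⟨by rw [ContinuousMap.add_apply, hA, hB, add_zero], ?_⟩
    exact (totalVar_add_le A B).trans_lt (ENNReal.add_lt_top.2 ⟨hA', hB'⟩)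
  smul_mem' := by
    rintro c A ⟨hA, hA'⟩
    refine ⟨by rw [ContinuousMap.smul_apply, hA, smul_zero], ?_⟩
    exact (totalVar_const_smul_le c A).trans_lt (ENNReal.mul_lt_top (by simp) hA')

/-- An element of the vector space `𝔸`, as an integrator. -/
def toIntegrator (A : integratorSubmodule T) : Integrator T := ⟨A.1, A.2⟩

lemma Skorokhod.integrable (x : Skorokhod T) (μ : Measure (TimeInterval T)) [IsFiniteMeasure μ] :
    MeasureTheory.Integrable x.1 μ :=
  integrable_of_bound (IsCadlag.measurable x.2) (IsCadlag.exists_bound x.2) μ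

/-- The pairing `(A, x) ↦ ∫_0^T x dA`, linear in both variables. -/
def integralBilin (T : ℝ) [Fact (0 < T)] : integratorSubmodule T →ₗ[ℝ] Skorokhod T →ₗ[ℝ] ℝ :=
  LinearMap.mk₂ ℝ (fun A x => (toIntegrator A).integral x.1)
    (fun A B x => by
      obtain ⟨α, β, _, _, hA⟩ := (toIntegrator A).exists_measures
      obtain ⟨α', β', _, _, hB⟩ := (toIntegrator B).exists_measures
      have hAB : ∀ t, (toIntegrator (A + B)).1 t = distFun (α + α') t - distFun (β + β') t := by
        intro t
        have : (toIntegrator (A + B)).1 t = (toIntegrator A).1 t + (toIntegrator B).1 t := rfl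
        rw [this, hA, hB, distFun_add, distFun_add, Pi.add_apply, Pi.add_apply]
        ring
      rw [Integrator.integral_eq_sub _ hAB, Integrator.integral_eq_sub _ hA,
        Integrator.integral_eq_sub _ hB,
        integral_add_measure (Skorokhod.integrable x _) (Skorokhod.integrable x _),
        integral_add_measure (Skorokhod.integrable x _) (Skorokhod.integrable x _)]
      ring)
    (fun c A x => by
      obtain ⟨α, β, _, _, hA⟩ := (toIntegrator A).exists_measures
      have hc : (c.toNNReal : ℝ) - ((-c).toNNReal : ℝ) = c := by
        rw [Real.coe_toNNReal', Real.coe_toNNReal']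
        exact max_zero_sub_eq_self _
      have hcA : ∀ t, (toIntegrator (c • A)).1 t =
          distFun (c.toNNReal • α + (-c).toNNReal • β) t -
            distFun (c.toNNReal • β + (-c).toNNReal • α) t := by
        intro t
        have : (toIntegrator (c • A)).1 t = c * (toIntegrator A).1 t := rfl
        rw [this, hA, distFun_add, distFun_add, Pi.add_apply, Pi.add_apply, distFun_nnreal_smul,
          distFun_nnreal_smul, distFun_nnreal_smul, distFun_nnreal_smul]
        nth_rewrite 1 [← hc]
        ring
      rw [Integrator.integral_eq_sub _ hcA, Integrator.integral_eq_sub _ hA,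
        integral_add_measure (Skorokhod.integrable x _) (Skorokhod.integrable x _),
        integral_add_measure (Skorokhod.integrable x _) (Skorokhod.integrable x _),
        integral_smul_nnreal_measure,
        integral_smul_nnreal_measure, integral_smul_nnreal_measure, integral_smul_nnreal_measure,
        NNReal.smul_def, NNReal.smul_def, NNReal.smul_def, NNReal.smul_def, smul_eq_mul,
        smul_eq_mul, smul_eq_mul, smul_eq_mul, smul_eq_mul]
      linear_combination (∫ t, x.1 t ∂α - ∫ t, x.1 t ∂β) * hc)
    (fun A => map_add (toIntegrator A).integralₗ)
    (fun c A => map_smul (toIntegrator A).integralₗ c)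

lemma integralBilin_apply (A : integratorSubmodule T) (x : Skorokhod T) :
    integralBilin T A x = (toIntegrator A).integral x.1 := rfl

end Bilinear

/-! ### Partitions adapted to a càdlàg function, and ramps -/

section Partition

variable {T : ℝ}

lemma notMem_closure_of_continuousWithinAt {X : Type*} [TopologicalSpace X] [LinearOrder X]
    {y : X → ℝ} {s : X} (hy : ContinuousWithinAt y (Ici s) s) {ε : ℝ} {S : Set X}
    (hs : ∀ w ∈ S, s ≤ w) (hS : ∀ w ∈ S, ε < y w) (h : y s < ε) : s ∉ closure S := by
  intro hmem
  have h1 : ∀ᶠ w in 𝓝[≥] s, y w < ε := hy.eventually_lt_const h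
  obtain ⟨w, hw, hwS⟩ := (mem_closure_iff_frequently.1 hmem).and_eventually
    (eventually_nhdsWithin_iff.1 h1) |>.exists
  exact absurd (hwS (hs w hw)) (not_lt.2 (hS w hw).le)

variable [Fact (0 < T)]

lemma left_lt_right : left T < right T := (Fact.out : 0 < T)

/-- The first time after `t` at which a càdlàg function has moved by `ε`, or `T` if there
is none. -/
lemma IsCadlag.exists_next {x : TimeInterval T → ℝ} (hx : IsCadlag x) {ε : ℝ} (hε : 0 < ε)
    {t : TimeInterval T} (ht : t < right T) :
    ∃ u, t < u ∧ (∀ w, t ≤ w → w < u → |x w - x t| ≤ ε) ∧ (u = right T ∨ ε ≤ |x u - x t|) := by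
  set S : Set (TimeInterval T) := {w | t < w ∧ ε < |x w - x t|} with hS
  rcases S.eq_empty_or_nonempty with hemp | hne
  · refine ⟨right T, ht, fun w hw _ => ?_, Or.inl rfl⟩
    by_contra! hlt
    rcases hw.eq_or_lt with rfl | hw
    · simp at hlt
      exact absurd hlt (not_lt.2 hε.le)
    · exact (hemp ▸ (show w ∈ S from ⟨hw, hlt⟩) : w ∈ (∅ : Set (TimeInterval T)))
  · have hc : ∀ s, ContinuousWithinAt (fun w => |x w - x t|) (Ici s) s := fun s =>
      ((hx.1 s).sub continuousWithinAt_const).abs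
    obtain ⟨u, hu, hul⟩ := isClosed_closure.isCompact.exists_isLeast hne.closure
    have hSu : ∀ w ∈ S, u ≤ w := fun w hw => hul (subset_closure hw)
    have htu : t < u := by
      have hle : t ≤ u := closure_minimal (fun w (hw : w ∈ S) => hw.1.le) isClosed_Ici hu
      refine hle.lt_of_ne ?_
      rintro rfl
      exact notMem_closure_of_continuousWithinAt (hc t) hSu (fun w hw => hw.2) (by simpa) hu
    refine ⟨u, htu, fun w hw hwu => ?_, Or.inr ?_⟩
    · by_contra! hlt
      rcases hw.eq_or_lt with rfl | hw
      · simp at hlt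
        exact absurd hlt (not_lt.2 hε.le)
      · exact absurd (hSu w ⟨hw, hlt⟩) (not_le.2 hwu)
    · by_contra! hlt
      exact notMem_closure_of_continuousWithinAt (hc u) hSu (fun w hw => hw.2) hlt hu

/-- The partition of `[0,T]` by the successive times at which a càdlàg function has moved by `ε`
since the preceding one. It is finite because left limits exist. -/
lemma IsCadlag.exists_partition {x : TimeInterval T → ℝ} (hx : IsCadlag x) {ε : ℝ} (hε : 0 < ε) :
    ∃ (k : ℕ) (p : ℕ → TimeInterval T), Monotone p ∧ p 0 = left T ∧ p (k + 1) = right T ∧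
      (∀ j ≤ k, p j < p (j + 1)) ∧
      (∀ j ≤ k, ∀ w, p j ≤ w → w < p (j + 1) → |x w - x (p j)| ≤ ε) ∧
      ∀ j < k, ε ≤ |x (p (j + 1)) - x (p j)| := by
  choose nx h1 h2 h3 using fun (t : TimeInterval T) (ht : t < right T) => hx.exists_next hε ht
  classical
  let p : ℕ → TimeInterval T := fun n =>
    Nat.rec (left T) (fun _ t => if h : t < right T then nx t h else right T) n
  have hp0 : p 0 = left T := rfl
  have hps : ∀ n (h : p n < right T), p (n + 1) = nx (p n) h := fun n h => dif_pos h
  have hpr : ∀ n, ¬ p n < right T → p (n + 1) = right T := fun n h => dif_neg h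
  have hmono : Monotone p := monotone_nat_of_le_succ fun n => by
    by_cases h : p n < right T
    · rw [hps n h]
      exact (h1 _ h).le
    · rw [hpr n h]
      exact isTop_right T _
  have hex : ∃ n, p n = right T := by
    by_contra! hne
    have hlt : ∀ n, p n < right T := fun n => (isTop_right T (p n)).lt_of_ne (hne n)
    have hstrict : StrictMono p := strictMono_nat_of_lt_succ fun n => by
      rw [hps n (hlt n)]
      exact h1 _ _
    have hbdd : BddAbove (range fun n => (p n).1) := by
      refine ⟨T, ?_⟩
      rintro _ ⟨n, rfl⟩
      exact (p n).2.2
    have hmono' : Monotone fun n => (p n).1 := fun a b h => hmono h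
    have hlim := tendsto_atTop_ciSup hmono' hbdd
    let q : TimeInterval T := ⟨_, isClosed_Icc.mem_of_tendsto hlim
      (Eventually.of_forall fun n => (p n).2)⟩
    have hq : Tendsto p atTop (𝓝 q) := tendsto_subtype_rng.2 hlim
    have hlt' : ∀ n, p n < q := fun n =>
      (hstrict n.lt_succ_self).trans_le (hmono.ge_of_tendsto hq (n + 1))
    obtain ⟨l, hl⟩ := hx.2 q
    have hl1 : Tendsto (fun n => x (p n)) atTop (𝓝 l) := hl.comp
      (tendsto_nhdsWithin_iff.2 ⟨hq, Eventually.of_forall hlt'⟩)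
    have hl2 := (((tendsto_add_atTop_iff_nat 1).2 hl1).sub hl1).abs
    rw [sub_self, abs_zero] at hl2
    obtain ⟨n, hn⟩ := (hl2.eventually_lt_const hε).exists
    have h4 := h3 (p n) (hlt n)
    rw [← hps n (hlt n)] at h4
    exact h4.elim (hne (n + 1)) fun h => absurd h (not_le.2 hn)
  obtain ⟨m, hspec, hmin⟩ : ∃ m, p m = right T ∧ ∀ j < m, p j < right T := by
    classical
    exact ⟨Nat.find hex, Nat.find_spec hex, fun j hj =>
      (isTop_right T (p j)).lt_of_ne (Nat.find_min hex hj)⟩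
  obtain ⟨k, rfl⟩ : ∃ k, m = k + 1 := Nat.exists_eq_succ_of_ne_zero fun h0 => by
    rw [h0] at hspec
    exact left_lt_right.ne hspec
  refine ⟨k, p, hmono, hp0, hspec, fun j hj => ?_, fun j hj w hw hw' => ?_, fun j hj => ?_⟩
  · rw [hps j (hmin j (by omega))]
    exact h1 _ _
  · rw [hps j (hmin j (by omega))] at hw'
    exact h2 _ _ w hw hw'
  · have h4 := h3 (p j) (hmin j (by omega))
    rw [← hps j (hmin j (by omega))] at h4
    exact h4.resolve_left (hmin (j + 1) (by omega)).ne

/-- A step function with jumps `d j` at `p j` is a difference of distribution functions. -/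
lemma exists_distFun_sub_eq_sum (d : ℕ → ℝ) (p : ℕ → TimeInterval T) (n : ℕ) :
    ∃ μ ν : Measure (TimeInterval T), IsFiniteMeasure μ ∧ IsFiniteMeasure ν ∧
      μ.real univ ≤ ∑ j ∈ Finset.range n, |d j| ∧ ν.real univ ≤ ∑ j ∈ Finset.range n, |d j| ∧
      ∀ t, distFun μ t - distFun ν t = ∑ j ∈ Finset.range n, if p j ≤ t then d j else 0 := by
  induction n with
  | zero => exact ⟨0, 0, inferInstance, inferInstance, by simp, by simp, by simp⟩
  | succ n ih =>
    obtain ⟨μ, ν, _, _, hμ, hν, h⟩ := ih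
    have hm : ∀ c : ℝ, (c.toNNReal • Measure.dirac (p n)).real univ ≤ |c| := fun c => by
      rw [← distFun_right, distFun_nnreal_smul, distFun_dirac, if_pos (isTop_right T _), mul_one,
        Real.coe_toNNReal']
      exact max_le (le_abs_self _) (abs_nonneg _)
    refine ⟨μ + (d n).toNNReal • Measure.dirac (p n), ν + (-d n).toNNReal • Measure.dirac (p n),
      inferInstance, inferInstance, ?_, ?_, fun t => ?_⟩
    · rw [measureReal_add_apply, Finset.sum_range_succ]
      exact add_le_add hμ (hm _)
    · rw [measureReal_add_apply, Finset.sum_range_succ]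
      exact add_le_add hν ((hm _).trans_eq (abs_neg _))
    · rw [distFun_add, distFun_add, Pi.add_apply, Pi.add_apply, Finset.sum_range_succ, ← h t,
        distFun_nnreal_smul, distFun_nnreal_smul, distFun_dirac, Real.coe_toNNReal',
        Real.coe_toNNReal']
      have h0 : max (d n) 0 - max (-d n) 0 = d n := max_zero_sub_eq_self _
      split_ifs <;> linarith

end Partition

section Ramp

variable {T : ℝ} [Fact (0 < T)]

/-- For `t < r` there is an integrator that increases from `0` to `1` on `[t,r]`. The integral
against it is an average over `[t,r]`. -/
lemma exists_ramp {t r : TimeInterval T} (htr : t < r) :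
    ∃ B : integratorSubmodule T, (∀ s, 0 ≤ B.1 s) ∧ (∀ s, B.1 s ≤ 1) ∧ (∀ s ≤ t, B.1 s = 0) ∧
      (∀ s, r ≤ s → B.1 s = 1) ∧ totalVar B.1 ≤ 1 ∧
      ∀ (x : Skorokhod T) (c η : ℝ), (∀ s, t ≤ s → s ≤ r → |x.1 s - c| ≤ η) →
        |integralBilin T B x - c| ≤ η := by
  have hpos : (0 : ℝ) < r - t := sub_pos.2 htr
  let f : C(TimeInterval T, ℝ) := ⟨fun s => max 0 (min 1 (((s : ℝ) - t) / (r - t))), by fun_prop⟩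
  have hf : ∀ s, f s = max 0 (min 1 (((s : ℝ) - t) / (r - t))) := fun _ => rfl
  have hmono : Monotone f := fun a b hab => by
    rw [hf, hf]
    have : (a : ℝ) ≤ b := hab
    gcongr
  have h0 : ∀ s, 0 ≤ f s := fun s => le_max_left _ _
  have h1 : ∀ s, f s ≤ 1 := fun s => max_le zero_le_one (min_le_left _ _)
  have ht : ∀ s ≤ t, f s = 0 := fun s hs => by
    rw [hf]
    have : (s : ℝ) ≤ t := hs
    exact max_eq_left ((min_le_right _ _).trans
      (div_nonpos_of_nonpos_of_nonneg (by linarith) hpos.le))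
  have hr : ∀ s, r ≤ s → f s = 1 := fun s hs => by
    rw [hf]
    have : (r : ℝ) ≤ s := hs
    rw [min_eq_left ((one_le_div hpos).2 (by linarith)), max_eq_right zero_le_one]
  have hvar : totalVar f ≤ 1 := by
    rw [totalVar_of_monotone hmono (h0 _), ← ENNReal.ofReal_one]
    exact ENNReal.ofReal_le_ofReal (h1 _)
  let B : integratorSubmodule T := ⟨f, ht _ (isBot_left T _), hvar.trans_lt ENNReal.one_lt_top⟩
  refine ⟨B, h0, h1, ht, hr, hvar, fun x c η hx => ?_⟩
  obtain ⟨α, hα, hα'⟩ := exists_eq_distFun hmono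
    (fun s => f.continuous.continuousWithinAt) (h0 _)
  have huniv : α.real univ = 1 := by
    rw [← distFun_right, ← hα', hr _ (isTop_right T _)]
  have hB : integralBilin T B x = ∫ s, x.1 s ∂α := by
    rw [integralBilin_apply, Integrator.integral_eq_sub (μ := α) (ν := 0) _ (fun s => ?_)]
    · simp
    · rw [← hα']
      simp only [distFun, measureReal_zero_apply, sub_zero]
      rfl
  have hae : ∀ᵐ s ∂α, ‖x.1 s - c‖ ≤ η := by
    have hl : ∀ᵐ s ∂α, ¬ s ≤ t := by
      rw [ae_iff]
      simp only [not_not]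
      refine (measureReal_eq_zero_iff).1 ?_
      exact (hα' t).symm.trans (ht t le_rfl)
    have hu : ∀ᵐ s ∂α, s ≤ r := by
      rw [ae_iff]
      refine (measureReal_eq_zero_iff).1 ?_
      have hc : {s : TimeInterval T | ¬ s ≤ r} = (Iic r)ᶜ := rfl
      have hd : α.real (Iic r) = 1 := (hα' r).symm.trans (hr r le_rfl)
      rw [hc, measureReal_compl measurableSet_Iic, huniv, hd, sub_self]
    filter_upwards [hl, hu] with s hs hs'
    exact hx s (not_le.1 hs).le hs'
  have hi : Integrable x.1 α := Skorokhod.integrable x α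
  have h := norm_integral_le_of_norm_le_const hae
  rw [integral_sub hi (integrable_const c), integral_const, huniv, one_smul, mul_one] at h
  rw [hB]
  exact h

end Ramp

/-! ### Integrators detecting the size of step approximations -/

section Dual

variable {T : ℝ} [Fact (0 < T)]

lemma totalVar_sum_le {ι : Type*} (s : Finset ι) (f : ι → TimeInterval T → ℝ) :
    totalVar (∑ i ∈ s, f i) ≤ ∑ i ∈ s, totalVar (f i) := by
  classical
  induction s using Finset.induction_on with
  | empty => simp [totalVar_zero]
  | insert a s ha ih =>
    rw [Finset.sum_insert ha, Finset.sum_insert ha]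
    exact (totalVar_add_le _ _).trans (add_le_add le_rfl ih)

/-- The values of `x` along a sequence of times, preceded by `0`. -/
def precedingValues (x : TimeInterval T → ℝ) (p : ℕ → TimeInterval T) : ℕ → ℝ
  | 0 => 0
  | j + 1 => x (p j)

/-- The step function with the values of `x` along a partition on which `x` oscillates by at most
`ε`. The measures are bounded in terms of the jumps of the step function before the time `T`. -/
lemma exists_step_approx {x : TimeInterval T → ℝ} {ε : ℝ} (hε : 0 < ε) {k : ℕ}
    {p : ℕ → TimeInterval T} (hmono : Monotone p) (hp0 : p 0 = left T) (hpk : p (k + 1) = right T)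
    (hosc : ∀ j ≤ k, ∀ w, p j ≤ w → w < p (j + 1) → |x w - x (p j)| ≤ ε) {V : ℝ}
    (hV : V = ∑ j ∈ Finset.range (k + 1), |precedingValues x p (j + 1) - precedingValues x p j|) :
    ∃ μ ν : Measure (TimeInterval T), IsFiniteMeasure μ ∧ IsFiniteMeasure ν ∧
      μ.real univ ≤ 2 * V + |x (right T)| ∧ ν.real univ ≤ 2 * V + |x (right T)| ∧
      ∀ t, |x t - (distFun μ t - distFun ν t)| ≤ ε := by
  set y := precedingValues x p
  have hy0 : y 0 = 0 := rfl
  have hys : ∀ j, y (j + 1) = x (p j) := fun _ => rfl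
  obtain ⟨μ, ν, hμ, hν, hμm, hνm, hsum⟩ :=
    exists_distFun_sub_eq_sum (fun j => y (j + 1) - y j) p (k + 2)
  have hmass : ∑ j ∈ Finset.range (k + 2), |y (j + 1) - y j| ≤ 2 * V + |x (right T)| := by
    rw [Finset.sum_range_succ, ← hV, hys, hys, hpk]
    have h1 : |x (p k)| ≤ V := by
      have h := Finset.sum_range_sub y (k + 1)
      rw [hy0, sub_zero, hys] at h
      rw [← h, hV]
      exact Finset.abs_sum_le_sum_abs _ _
    linarith [abs_sub (x (right T)) (x (p k))]
  refine ⟨μ, ν, hμ, hν, hμm.trans hmass, hνm.trans hmass, fun t => ?_⟩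
  rw [hsum]
  -- the jumps up to time `t` are the first `i + 1` ones, and their sum telescopes
  have hval : ∀ i ≤ k + 1, p i ≤ t → (∀ j, i < j → j ≤ k + 1 → t < p j) →
      (∑ j ∈ Finset.range (k + 2), if p j ≤ t then y (j + 1) - y j else 0) = x (p i) := by
    intro i hi hit hti
    rw [← Finset.sum_filter]
    have : (Finset.range (k + 2)).filter (fun j => p j ≤ t) = Finset.range (i + 1) := by
      ext j
      simp only [Finset.mem_filter, Finset.mem_range]
      constructor
      · rintro ⟨hj, hjt⟩
        by_contra hcon
        exact absurd (hti j (by omega) (by omega)) (not_lt.2 hjt)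
      · intro hj
        exact ⟨by omega, (hmono (by omega)).trans hit⟩
    rw [this, Finset.sum_range_sub, hys, hy0, sub_zero]
  have hex : ∃ i ≤ k + 1, p i ≤ t ∧ ∀ j, i < j → j ≤ k + 1 → t < p j := by
    classical
    let i := Nat.findGreatest (fun i => p i ≤ t) (k + 1)
    refine ⟨i, Nat.findGreatest_le _, ?_, fun j hj hjk => ?_⟩
    · exact Nat.findGreatest_spec (P := fun i => p i ≤ t) (Nat.zero_le _)
        (by rw [hp0]; exact isBot_left T t)
    · exact not_le.1 (Nat.findGreatest_is_greatest hj hjk)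
  obtain ⟨i, hik, hit, hti⟩ := hex
  rw [hval i hik hit hti]
  rcases Nat.lt_or_ge k i with hki | hki
  · have : i = k + 1 := by omega
    subst this
    rw [hpk] at hit ⊢
    rw [le_antisymm (isTop_right T t) hit, sub_self, abs_zero]
    exact hε.le
  · exact hosc i hki t hit (hti (i + 1) (by omega) (by omega))

lemma abs_mul_sign_le {c : ℝ} (hc : 0 ≤ c) (r : ℝ) : |c * (SignType.sign r : ℝ)| ≤ c := by
  rw [abs_mul, abs_of_nonneg hc]
  refine mul_le_of_le_one_right hc ?_
  rcases lt_trichotomy r 0 with h | h | h <;> simp [h]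

section Telescope

variable {b : ℕ → integratorSubmodule T} {a : ℕ → ℝ} {c : ℝ} {k : ℕ}

lemma coe_sum_smul_sub (s : TimeInterval T) :
    (∑ j ∈ Finset.range (k + 1), a j • (b (j + 1) - b j)).1 s =
      ∑ j ∈ Finset.range (k + 1), a j * ((b (j + 1)).1 s - (b j).1 s) := by
  simp only [AddSubmonoidClass.coe_finsetSum, ContinuousMap.sum_apply]
  rfl

lemma totalVar_sum_smul_sub_le (hc0 : 0 ≤ c) (ha : ∀ j, |a j| ≤ c)
    (hbvar : ∀ j ≤ k + 1, totalVar (b j).1 ≤ 1) :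
    totalVar (∑ j ∈ Finset.range (k + 1), a j • (b (j + 1) - b j)).1 ≤
      ENNReal.ofReal ((k + 1) * (c * 2)) := by
  have hA' : ((∑ j ∈ Finset.range (k + 1), a j • (b (j + 1) - b j)).1 : TimeInterval T → ℝ) =
      ∑ j ∈ Finset.range (k + 1), a j •
        (((b (j + 1)).1 : TimeInterval T → ℝ) - ((b j).1 : TimeInterval T → ℝ)) := by
    ext s
    rw [Finset.sum_apply]
    exact coe_sum_smul_sub s
  rw [hA']
  calc _ ≤ ∑ j ∈ Finset.range (k + 1), ENNReal.ofReal (c * 2) := by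
        refine (totalVar_sum_le _ _).trans (Finset.sum_le_sum fun j hj => ?_)
        rw [Finset.mem_range] at hj
        refine (totalVar_const_smul_le _ _).trans ?_
        rw [ENNReal.ofReal_mul hc0]
        refine mul_le_mul' ?_ ((totalVar_sub_le _ _).trans ?_)
        · rw [← ofReal_norm]
          exact ENNReal.ofReal_le_ofReal (ha j)
        · refine (add_le_add (hbvar _ (by omega)) (hbvar _ (by omega))).trans_eq ?_
          norm_num
    _ = ENNReal.ofReal ((k + 1) * (c * 2)) := by
        rw [Finset.sum_const, Finset.card_range, nsmul_eq_mul,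
          ← Nat.cast_succ, ENNReal.ofReal_mul (Nat.cast_nonneg _), ENNReal.ofReal_natCast]

/-- Since the functions `b (j + 1)` decrease in `j`, their differences add up to at most `2`, no
matter how many there are. -/
lemma abs_sum_smul_sub_le (hc0 : 0 ≤ c) (ha : ∀ j, |a j| ≤ c) (hb0 : b 0 = 0)
    (hnonneg : ∀ j ≤ k, ∀ s, 0 ≤ (b (j + 1)).1 s) (hle : ∀ s, (b 1).1 s ≤ 1)
    (hbanti : ∀ j, j + 1 ≤ k → ∀ s, (b (j + 2)).1 s ≤ (b (j + 1)).1 s) (s : TimeInterval T) :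
    |(∑ j ∈ Finset.range (k + 1), a j • (b (j + 1) - b j)).1 s| ≤ c * 2 := by
  have h1 : |(∑ j ∈ Finset.range (k + 1), a j • (b (j + 1) - b j)).1 s| ≤
      ∑ j ∈ Finset.range (k + 1), c * |(b (j + 1)).1 s - (b j).1 s| := by
    rw [coe_sum_smul_sub]
    refine (Finset.abs_sum_le_sum_abs _ _).trans (Finset.sum_le_sum fun j _ => ?_)
    rw [abs_mul]
    exact mul_le_mul_of_nonneg_right (ha j) (abs_nonneg _)
  have h2 : ∑ j ∈ Finset.range (k + 1), |(b (j + 1)).1 s - (b j).1 s| ≤ 2 := by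
    rw [Finset.sum_range_succ']
    have h3 : ∑ j ∈ Finset.range k, |(b (j + 1 + 1)).1 s - (b (j + 1)).1 s| =
        (b 1).1 s - (b (k + 1)).1 s := by
      rw [← Finset.sum_range_sub' (fun j => (b (j + 1)).1 s)]
      refine Finset.sum_congr rfl fun j hj => ?_
      rw [abs_of_nonpos (sub_nonpos.2 (hbanti j (Finset.mem_range.1 hj) s)), neg_sub]
    have h4 : (b 0).1 s = 0 := by
      rw [hb0]
      rfl
    have h5 := hle s
    have h6 := hnonneg 0 (Nat.zero_le _) s
    have h7 := hnonneg k le_rfl s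
    rw [h3, h4, sub_zero, zero_add, abs_of_nonneg h6]
    rw [zero_add] at h6 ⊢
    linarith
  rw [← Finset.mul_sum] at h1
  exact h1.trans (mul_le_mul_of_nonneg_left h2 hc0)

lemma le_integralBilin_sum_sign_smul_sub (hc0 : 0 ≤ c) (x : Skorokhod T) {y : ℕ → ℝ} {η : ℝ}
    (hb : ∀ j ≤ k + 1, |integralBilin T (b j) x - y j| ≤ η) :
    c * (∑ j ∈ Finset.range (k + 1), |y (j + 1) - y j|) - (k + 1) * (c * (2 * η)) ≤
      integralBilin T (∑ j ∈ Finset.range (k + 1),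
        (c * (SignType.sign (y (j + 1) - y j) : ℝ)) • (b (j + 1) - b j)) x := by
  have h1 : integralBilin T (∑ j ∈ Finset.range (k + 1),
      (c * (SignType.sign (y (j + 1) - y j) : ℝ)) • (b (j + 1) - b j)) x =
      ∑ j ∈ Finset.range (k + 1), (c * (SignType.sign (y (j + 1) - y j) : ℝ)) *
        (integralBilin T (b (j + 1)) x - integralBilin T (b j) x) := by
    simp only [map_sum, map_smul, map_sub, LinearMap.sum_apply, LinearMap.smul_apply,
      LinearMap.sub_apply, smul_eq_mul]
  have h2 : ∀ j ∈ Finset.range (k + 1), c * |y (j + 1) - y j| - c * (2 * η) ≤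
      (c * (SignType.sign (y (j + 1) - y j) : ℝ)) *
        (integralBilin T (b (j + 1)) x - integralBilin T (b j) x) := by
    intro j hj
    rw [Finset.mem_range] at hj
    have e1 := abs_le.1 (hb (j + 1) (by omega))
    have e2 := abs_le.1 (hb j (by omega))
    have e3 : c * (SignType.sign (y (j + 1) - y j) : ℝ) * (y (j + 1) - y j) =
        c * |y (j + 1) - y j| := by
      rw [mul_assoc, sign_mul_self]
    have e4 : |c * (SignType.sign (y (j + 1) - y j) : ℝ) *
        ((integralBilin T (b (j + 1)) x - integralBilin T (b j) x) - (y (j + 1) - y j))| ≤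
          c * (2 * η) := by
      rw [abs_mul]
      refine mul_le_mul (abs_mul_sign_le hc0 _) ?_ (abs_nonneg _) hc0
      rw [abs_le]
      constructor <;> linarith
    have e5 := (abs_le.1 e4).1
    rw [mul_sub, e3] at e5
    linarith
  have h3 := Finset.sum_le_sum h2
  rw [← h1, Finset.sum_sub_distrib, ← Finset.mul_sum, Finset.sum_const,
    Finset.card_range, nsmul_eq_mul] at h3
  push_cast at h3
  exact h3

end Telescope

/-- Ramps so steep that the integrals against them nearly evaluate `x` at the times `p j`. Each
of them reaches `1` before the next one starts, so they decrease in `j`. -/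
lemma exists_ramps (x : Skorokhod T) {η : ℝ} (hη : 0 < η) {k : ℕ} {p : ℕ → TimeInterval T}
    (hlt : ∀ j ≤ k, p j < p (j + 1)) :
    ∃ b : ℕ → integratorSubmodule T, b 0 = 0 ∧ (∀ j ≤ k, ∀ s, 0 ≤ (b (j + 1)).1 s) ∧
      (∀ s, (b 1).1 s ≤ 1) ∧ (∀ j, j + 1 ≤ k → ∀ s, (b (j + 2)).1 s ≤ (b (j + 1)).1 s) ∧
      (∀ j ≤ k + 1, totalVar (b j).1 ≤ 1) ∧
      ∀ j ≤ k + 1, |integralBilin T (b j) x - precedingValues x.1 p j| ≤ η := by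
  have hramp : ∀ j, ∃ B : integratorSubmodule T, j ≤ k →
      (∀ s, 0 ≤ B.1 s) ∧ (∀ s, B.1 s ≤ 1) ∧ (∀ s ≤ p j, B.1 s = 0) ∧
      (∀ s, p (j + 1) ≤ s → B.1 s = 1) ∧ totalVar B.1 ≤ 1 ∧
      |integralBilin T B x - x.1 (p j)| ≤ η := by
    intro j
    by_cases hj : j ≤ k
    · have hc : ∀ᶠ s in 𝓝[≥] (p j), |x.1 s - x.1 (p j)| < η := by
        have h1 : ContinuousWithinAt (fun s => |x.1 s - x.1 (p j)|) (Ici (p j)) (p j) :=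
          ((x.2.1 (p j)).sub continuousWithinAt_const).abs
        exact h1.eventually_lt_const (by simpa using hη)
      obtain ⟨u, hu, hu'⟩ := (mem_nhdsGE_iff_exists_Ico_subset' (hlt j hj)).1 hc
      obtain ⟨r, hr1, hr2⟩ := exists_between (lt_min (show p j < u from hu) (hlt j hj))
      obtain ⟨B, h1, h2, h3, h4, h5, h6⟩ := exists_ramp hr1
      refine ⟨B, fun _ => ⟨h1, h2, h3, fun s hs => h4 s ?_, h5, h6 x _ _ fun s hs hs' => ?_⟩⟩
      · exact (hr2.trans_le (min_le_right _ _)).le.trans hs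
      · exact (hu' ⟨hs, hs'.trans_lt (hr2.trans_le (min_le_left _ _))⟩ : _ < _).le
    · exact ⟨0, fun h => absurd h hj⟩
  choose B hB using hramp
  refine ⟨fun j => Nat.casesOn j 0 fun i => B i, rfl, fun j hj => (hB j hj).1,
    (hB 0 (Nat.zero_le _)).2.1, fun j hj s => ?_, fun j hj => ?_, fun j hj => ?_⟩
  · change (B (j + 1)).1 s ≤ (B j).1 s
    rcases le_total s (p (j + 1)) with hs | hs
    · rw [(hB (j + 1) hj).2.2.1 s hs]
      exact (hB j (by omega)).1 s
    · rw [(hB j (by omega)).2.2.2.1 s hs]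
      exact (hB (j + 1) hj).2.1 s
  · cases j with
    | zero =>
      change totalVar ((0 : integratorSubmodule T).1 : TimeInterval T → ℝ) ≤ 1
      rw [Submodule.coe_zero, ContinuousMap.coe_zero, totalVar_zero]
      exact zero_le_one
    | succ j => exact (hB j (by omega)).2.2.2.2.1
  · cases j with
    | zero =>
      change |integralBilin T 0 x - 0| ≤ η
      rw [map_zero, LinearMap.zero_apply, sub_zero, abs_zero]
      exact hη.le
    | succ j => exact (hB j (by omega)).2.2.2.2.2

/-- A step approximation of a càdlàg function within `ε`, together with an integrator that detects
its size. If the step function jumps by `d_j` at `p_j`, and `V = ∑ |d_j|`, the integrator is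
`c ∑ sgn(d_j) (B_j - B_{j-1})` where `B_j` is a steep ramp to the right of `p_j`, so that the
integral of `x` is nearly `c V`. -/
lemma exists_approx_and_witness (x : Skorokhod T) {ε : ℝ} (hε : 0 < ε) :
    ∃ V : ℝ, 0 ≤ V ∧
      (∃ μ ν : Measure (TimeInterval T), IsFiniteMeasure μ ∧ IsFiniteMeasure ν ∧
        μ.real univ ≤ 2 * V + |x.1 (right T)| ∧ ν.real univ ≤ 2 * V + |x.1 (right T)| ∧
        ∀ t, |x.1 t - (distFun μ t - distFun ν t)| ≤ ε) ∧
      (ε ≤ V → ∃ A : Integrator T, totalVar A.1 ≤ 2 ∧ (∀ s, |A.1 s| ≤ 2 * ε / V) ∧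
        ε / 4 ≤ A.integral x.1) := by
  obtain ⟨k, p, hmono, hp0, hpk, hlt, hosc, hjump⟩ := IsCadlag.exists_partition x.2 hε
  set y := precedingValues x.1 p
  have hys : ∀ j, y (j + 1) = x.1 (p j) := fun _ => rfl
  set V : ℝ := ∑ j ∈ Finset.range (k + 1), |y (j + 1) - y j| with hV
  have hV0 : 0 ≤ V := Finset.sum_nonneg fun _ _ => abs_nonneg _
  refine ⟨V, hV0, exists_step_approx hε hmono hp0 hpk hosc hV, fun hεV => ?_⟩
  have hVpos : 0 < V := hε.trans_le hεV
  obtain ⟨b, hb0, hnonneg, hle, hanti, hbvar, hbint⟩ :=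
    exists_ramps x (show 0 < ε / 8 by positivity) hlt
  -- this choice makes both `c * (k + 1) ≤ 1` and `ε / 2 ≤ c * V`
  set c : ℝ := ε / (ε + V) with hc
  have hc0 : 0 < c := by positivity
  -- every jump but the first is at least `ε`, which bounds their number
  have hk : c * (k + 1) ≤ 1 := by
    have h1 : (k : ℝ) * ε ≤ V := by
      rw [hV, Finset.sum_range_succ']
      have h2 : ∑ j ∈ Finset.range k, ε ≤ ∑ j ∈ Finset.range k, |y (j + 1 + 1) - y (j + 1)| :=
        Finset.sum_le_sum fun j hj => hjump j (Finset.mem_range.1 hj)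
      rw [Finset.sum_const, Finset.card_range, nsmul_eq_mul] at h2
      linarith [abs_nonneg (y (0 + 1) - y 0)]
    rw [hc, div_mul_eq_mul_div, div_le_one (by positivity)]
    linarith
  have hcV : ε / 2 ≤ c * V := by
    rw [hc, div_mul_eq_mul_div, div_le_div_iff₀ (by norm_num) (by positivity)]
    nlinarith
  refine ⟨toIntegrator (∑ j ∈ Finset.range (k + 1),
    (c * (SignType.sign (y (j + 1) - y j) : ℝ)) • (b (j + 1) - b j)), ?_, fun s => ?_, ?_⟩
  · refine (totalVar_sum_smul_sub_le hc0.le (fun j => abs_mul_sign_le hc0.le _) hbvar).trans ?_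
    rw [← ENNReal.ofReal_ofNat 2]
    exact ENNReal.ofReal_le_ofReal (by linarith)
  · refine (abs_sum_smul_sub_le hc0.le (fun j => abs_mul_sign_le hc0.le _) hb0 hnonneg hle hanti
      s).trans ?_
    rw [hc, div_mul_eq_mul_div, mul_comm]
    exact div_le_div_of_nonneg_left (by positivity) hVpos (by linarith)
  · have h := le_integralBilin_sum_sign_smul_sub hc0.le x hbint
    rw [← hV, integralBilin_apply] at h
    refine le_trans ?_ h
    nlinarith

end Dual

/-! ### From `S`-convergence to uniform convergence of integrals -/

section SigmaConv

variable {T : ℝ} [Fact (0 < T)]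

/-- `f ↦ ∫ f dv` as a continuous functional on `C([0,T])`. -/
lemma SkorokhodBV.exists_clm (v : SkorokhodBV T) :
    ∃ L : C(TimeInterval T, ℝ) →L[ℝ] ℝ, ∀ f, L f = v.integral f := by
  obtain ⟨μ, ν, _, _, hv⟩ := v.exists_measures
  have hi : ∀ (f : C(TimeInterval T, ℝ)) (κ : Measure (TimeInterval T)) [IsFiniteMeasure κ],
      Integrable f κ := fun f κ _ =>
    integrable_of_bound f.continuous.measurable (bounded_of_continuous f) κ
  have hb : ∀ (f : C(TimeInterval T, ℝ)) (κ : Measure (TimeInterval T)) [IsFiniteMeasure κ],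
      ‖∫ t, f t ∂κ‖ ≤ ‖f‖ * κ.real univ := fun f κ _ =>
    norm_integral_le_of_norm_le_const (Eventually.of_forall f.norm_coe_le_norm)
  refine ⟨LinearMap.mkContinuous
    { toFun := fun f => ∫ t, f t ∂μ - ∫ t, f t ∂ν
      map_add' := fun f g => ?_
      map_smul' := fun c f => ?_ } (μ.real univ + ν.real univ) fun f => ?_, fun f => ?_⟩
  · simp only [ContinuousMap.add_apply]
    rw [integral_add (hi f μ) (hi g μ), integral_add (hi f ν) (hi g ν)]
    ring
  · simp only [ContinuousMap.smul_apply, RingHom.id_apply]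
    rw [integral_smul, integral_smul, smul_sub]
  · change ‖∫ t, f t ∂μ - ∫ t, f t ∂ν‖ ≤ _
    refine (norm_sub_le _ _).trans ?_
    linarith [hb f μ, hb f ν]
  · exact (v.integral_eq_sub hv f).symm

lemma SkorokhodBV.integral_one (v : SkorokhodBV T) :
    v.integral (1 : C(TimeInterval T, ℝ)) = v.1.1 (right T) := by
  obtain ⟨μ, ν, _, _, hv⟩ := v.exists_measures
  rw [v.integral_eq_sub hv, hv, distFun_right, distFun_right]
  simp

lemma SkorokhodBV.WeakStarConv.tendsto_right {v : ℕ → SkorokhodBV T} {v₀ : SkorokhodBV T}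
    (h : SkorokhodBV.WeakStarConv v v₀) :
    Tendsto (fun n => (v n).1.1 (right T)) atTop (𝓝 (v₀.1.1 (right T))) := by
  simpa only [SkorokhodBV.integral_one] using h 1

/-- The pairing of `𝔸` with `𝕍` is jointly sequentially continuous. By the uniform boundedness
principle the functionals `dv_n` are bounded, so uniform convergence of the `A_n` suffices. -/
lemma SkorokhodBV.WeakStarConv.tendsto_integral {v : ℕ → SkorokhodBV T} {v₀ : SkorokhodBV T}
    (h : SkorokhodBV.WeakStarConv v v₀) {A : ℕ → Integrator T} {A₀ : Integrator T}
    (hA : TauConv A A₀) :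
    Tendsto (fun n => (A n).integral (v n).1.1) atTop (𝓝 (A₀.integral v₀.1.1)) := by
  choose L hL using fun n => (v n).exists_clm
  obtain ⟨C, hC⟩ : ∃ C, ∀ n, ‖L n‖ ≤ C := banach_steinhaus fun f => by
    have h1 := (h f).norm.bddAbove_range
    obtain ⟨C, hC⟩ := h1
    exact ⟨C, fun n => by rw [hL]; exact hC (mem_range_self n)⟩
  have hAn : Tendsto (fun n => (A n).1) atTop (𝓝 A₀.1) :=
    (ContinuousMap.tendsto_iff_tendstoUniformly).2 hA.1
  have hpt : Tendsto (fun n => (A n).1 (right T)) atTop (𝓝 (A₀.1 (right T))) :=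
    hA.1.tendsto_at (right T)
  have hdiff : Tendsto (fun n => L n ((A n).1 - A₀.1)) atTop (𝓝 0) := by
    refine squeeze_zero_norm (a := fun n => C * ‖(A n).1 - A₀.1‖) (fun n => ?_) ?_
    · exact (L n).le_of_opNorm_le (hC n) _
    · simpa using (tendsto_iff_norm_sub_tendsto_zero.1 hAn).const_mul C
  have hint : Tendsto (fun n => (v n).integral (A n).1) atTop (𝓝 (v₀.integral A₀.1)) := by
    have h1 : Tendsto (fun n => L n A₀.1) atTop (𝓝 (v₀.integral A₀.1)) := by
      simpa only [hL] using h A₀.1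
    have h2 := hdiff.add h1
    simp only [map_sub, sub_add_cancel, zero_add] at h2
    simpa only [hL] using h2
  simp only [Integrator.integral_skorokhodBV]
  exact (h.tendsto_right.mul hpt).sub hint

lemma TauConv.exists_bound {A : ℕ → Integrator T} {A₀ : Integrator T} (h : TauConv A A₀) :
    ∃ C : ℝ, 0 ≤ C ∧ (∀ n, (totalVar (A n).1).toReal ≤ C) ∧ (totalVar A₀.1).toReal ≤ C := by
  refine ⟨(⨆ n, totalVar (A n).1).toReal + (totalVar A₀.1).toReal, by positivity, fun n => ?_,
    le_add_of_nonneg_left ENNReal.toReal_nonneg⟩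
  exact (ENNReal.toReal_mono h.2.ne (le_iSup (fun n => totalVar (A n).1) n)).trans
    (le_add_of_nonneg_right ENNReal.toReal_nonneg)

lemma Integrator.abs_integral_sub_le (A : Integrator T) {x y : Skorokhod T} {C : ℝ}
    (h : ∀ t, |x.1 t - y.1 t| ≤ C) :
    |A.integral x.1 - A.integral y.1| ≤ C * (totalVar A.1).toReal := by
  rw [← A.integral_sub]
  exact A.abs_integral_le h

/-- The pairing of `𝔸` with `𝔻` is jointly sequentially continuous. -/
lemma SConv.tendsto_integral {x : ℕ → Skorokhod T} {x₀ : Skorokhod T} (h : SConv x x₀)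
    {A : ℕ → Integrator T} {A₀ : Integrator T} (hA : TauConv A A₀) :
    Tendsto (fun n => (A n).integral (x n).1) atTop (𝓝 (A₀.integral x₀.1)) := by
  obtain ⟨C, hC0, hC, hC'⟩ := hA.exists_bound
  rw [Metric.tendsto_atTop']
  intro ε hε
  obtain ⟨v, v₀, h₁, h₂, h₃⟩ := h (ε / (3 * (C + 1))) (by positivity)
  have hle : ∀ r : ℝ, r ≤ C → ε / (3 * (C + 1)) * r < ε / 3 := fun r hr => by
    have h1 : ε / (3 * (C + 1)) * (C + 1) = ε / 3 := by field_simp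
    have h2 : ε / (3 * (C + 1)) * r < ε / (3 * (C + 1)) * (C + 1) :=
      mul_lt_mul_of_pos_left (by linarith) (by positivity)
    linarith
  obtain ⟨N, hN⟩ := (Metric.tendsto_atTop'.1 (h₃.tendsto_integral hA)) (ε / 3) (by positivity)
  refine ⟨N, fun n hn => ?_⟩
  have e1 := ((A n).abs_integral_sub_le (h₁ n)).trans_lt (hle _ (hC n))
  have e2 := (A₀.abs_integral_sub_le h₂).trans_lt (hle _ hC')
  have e3 := hN n hn
  rw [Real.dist_eq, abs_lt] at e3 ⊢
  rw [abs_lt] at e1 e2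
  constructor <;> linarith

/-- The step approximations show that constant sequences converge. -/
lemma sConv_const (x₀ : Skorokhod T) : SConv (fun _ => x₀) x₀ := by
  intro ε hε
  obtain ⟨-, -, ⟨μ, ν, _, _, -, -, h⟩, -⟩ := exists_approx_and_witness x₀ hε
  exact ⟨fun _ => SkorokhodBV.ofMeasures μ ν, SkorokhodBV.ofMeasures μ ν, fun _ => h, h,
    fun _ => tendsto_const_nhds⟩

lemma SConv.tendsto_right {x : ℕ → Skorokhod T} {x₀ : Skorokhod T} (h : SConv x x₀) :
    Tendsto (fun n => (x n).1 (right T)) atTop (𝓝 (x₀.1 (right T))) := by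
  rw [Metric.tendsto_atTop']
  intro ε hε
  obtain ⟨v, v₀, h₁, h₂, h₃⟩ := h (ε / 4) (by positivity)
  obtain ⟨N, hN⟩ := (Metric.tendsto_atTop'.1 h₃.tendsto_right) (ε / 4) (by positivity)
  refine ⟨N, fun n hn => ?_⟩
  have e1 := h₁ n (right T)
  have e2 := h₂ (right T)
  have e3 := hN n hn
  rw [Real.dist_eq, abs_lt] at e3 ⊢
  rw [abs_le] at e1 e2
  constructor <;> linarith

/-- Convergence at `T` together with convergence of the integrals, uniformly over each relatively
`τ`-compact set of integrators. -/
def SigmaConv (x : ℕ → Skorokhod T) (x₀ : Skorokhod T) : Prop :=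
  Tendsto (fun n => (x n).1 (right T)) atTop (𝓝 (x₀.1 (right T))) ∧
    ∀ 𝒜 : Set (Integrator T), IsRelTauCompact 𝒜 →
      Tendsto (fun n => ⨆ A ∈ 𝒜, ENNReal.ofReal |A.integral (x n - x₀).1|) atTop (𝓝 0)

lemma tendsto_biSup_ofReal_iff {ι : Type*} {l : Filter ι} {α : Type*} {s : Set α}
    {f : ι → α → ℝ} :
    Tendsto (fun n => ⨆ a ∈ s, ENNReal.ofReal |f n a|) l (𝓝 0) ↔
      ∀ ε : ℝ, 0 < ε → ∀ᶠ n in l, ∀ a ∈ s, |f n a| ≤ ε := by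
  rw [ENNReal.tendsto_nhds_zero]
  constructor
  · intro h ε hε
    filter_upwards [h (ENNReal.ofReal ε) (ENNReal.ofReal_pos.2 hε)] with n hn a ha
    exact (ENNReal.ofReal_le_ofReal_iff hε.le).1
      ((le_iSup₂ (f := fun a (_ : a ∈ s) => ENNReal.ofReal |f n a|) a ha).trans hn)
  · intro h ε hε
    rcases eq_or_ne ε ∞ with rfl | hε'
    · exact Eventually.of_forall fun _ => le_top
    · filter_upwards [h ε.toReal (ENNReal.toReal_pos hε.ne' hε')] with n hn
      exact iSup₂_le fun a ha => ENNReal.ofReal_le_of_le_toReal (hn a ha)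

lemma SConv.sigmaConv {x : ℕ → Skorokhod T} {x₀ : Skorokhod T} (h : SConv x x₀) :
    SigmaConv x x₀ := by
  refine ⟨h.tendsto_right, fun 𝒜 h𝒜 => tendsto_biSup_ofReal_iff.2 fun ε hε => ?_⟩
  by_contra hcon
  obtain ⟨φ, hφ, hφ'⟩ := extraction_of_frequently_atTop (not_eventually.1 hcon)
  push Not at hφ'
  choose A hA hlt using hφ'
  obtain ⟨A₀, ψ, hψ, hτ⟩ := h𝒜 A hA
  have h1 := ((h.comp hφ).comp hψ).tendsto_integral hτ
  have h2 := (sConv_const x₀).tendsto_integral hτ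
  have h3 := (h1.sub h2).abs
  rw [sub_self, abs_zero] at h3
  obtain ⟨k, hk⟩ := (h3.eventually_lt_const hε).exists
  have := hlt (ψ k)
  rw [Integrator.integral_sub] at this
  exact absurd this (not_lt.2 hk.le)

/-- A limit that holds along `S`-convergent sequences holds along `→*_S`-convergent ones. -/
lemma SStarConv.tendsto_of_sConv {x : ℕ → Skorokhod T} {x₀ : Skorokhod T} (h : SStarConv x x₀)
    {β : Type*} {F : Skorokhod T → β} {l : Filter β}
    (H : ∀ y : ℕ → Skorokhod T, SConv y x₀ → Tendsto (fun n => F (y n)) atTop l) :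
    Tendsto (fun n => F (x n)) atTop l := by
  refine tendsto_of_subseq_tendsto fun ns hns => ?_
  obtain ⟨θ, -, hθ'⟩ := strictMono_subseq_of_tendsto_atTop hns
  obtain ⟨ψ, -, hψ⟩ := h _ hθ'
  exact ⟨θ ∘ ψ, H _ hψ⟩

lemma SStarConv.sigmaConv {x : ℕ → Skorokhod T} {x₀ : Skorokhod T} (h : SStarConv x x₀) :
    SigmaConv x x₀ :=
  ⟨h.tendsto_of_sConv (F := fun y => y.1 (right T)) fun _ hy => hy.sigmaConv.1,
    fun 𝒜 h𝒜 => h.tendsto_of_sConv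
      (F := fun y => ⨆ A ∈ 𝒜, ENNReal.ofReal |A.integral (y - x₀).1|)
      fun _ hy => hy.sigmaConv.2 𝒜 h𝒜⟩

end SigmaConv

/-! ### Boundedness of step approximations -/

section Bounded

variable {T : ℝ} [Fact (0 < T)]

lemma TauConv.comp {A : ℕ → Integrator T} {A₀ : Integrator T} (h : TauConv A A₀) {φ : ℕ → ℕ}
    (hφ : Tendsto φ atTop atTop) : TauConv (A ∘ φ) A₀ := by
  refine ⟨fun u hu => hφ.eventually (h.1 u hu), lt_of_le_of_lt ?_ h.2⟩
  exact iSup_le fun n => le_iSup (fun n => totalVar (A n).1) (φ n)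

lemma tauConv_const (A₀ : Integrator T) : TauConv (fun _ => A₀) A₀ := by
  refine ⟨fun u hu => Eventually.of_forall fun _ t => refl_mem_uniformity hu, ?_⟩
  rw [ciSup_const]
  exact A₀.2.2

lemma TauConv.isRelTauCompact_range {A : ℕ → Integrator T} {A₀ : Integrator T}
    (h : TauConv A A₀) : IsRelTauCompact (range A) := by
  intro B hB
  choose m hm using hB
  obtain rfl : A ∘ m = B := funext hm
  by_cases hfreq : ∃ j, ∃ᶠ n in atTop, m n = j
  · obtain ⟨j, hj⟩ := hfreq
    obtain ⟨φ, hφ, hφj⟩ := extraction_of_frequently_atTop hj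
    refine ⟨A j, φ, hφ, ?_⟩
    convert tauConv_const (A j) using 1
    funext n
    simp [hφj]
  · push Not at hfreq
    have ht : Tendsto m atTop atTop := by
      rw [← Nat.cofinite_eq_atTop]
      refine le_cofinite_iff_eventually_ne.2 fun j => ?_
      rw [Nat.cofinite_eq_atTop]
      exact eventually_map.2 (hfreq j)
    obtain ⟨φ, hφ, hφ'⟩ := strictMono_subseq_of_tendsto_atTop ht
    exact ⟨A₀, φ, hφ, h.comp hφ'.tendsto_atTop⟩

/-- A `Σ`-convergent sequence is approximated within `ε` by functions of bounded total variation.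
Otherwise the integrators that detect the size of the step approximations tend to `0` along a
subsequence for `τ`, while their integrals do not. -/
lemma SigmaConv.exists_bounded_approx {x : ℕ → Skorokhod T} {x₀ : Skorokhod T}
    (h : SigmaConv x x₀) {ε : ℝ} (hε : 0 < ε) :
    ∃ K : ℝ, ∀ n, ∃ μ ν : Measure (TimeInterval T), IsFiniteMeasure μ ∧ IsFiniteMeasure ν ∧
      μ.real univ ≤ K ∧ ν.real univ ≤ K ∧ ∀ t, |(x n).1 t - (distFun μ t - distFun ν t)| ≤ ε := by
  choose V hV0 happ hwit using fun n => exists_approx_and_witness (x n) hε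
  obtain ⟨C, hC⟩ := h.1.abs.bddAbove_range
  have hC' : ∀ n, |(x n).1 (right T)| ≤ C := fun n => hC (mem_range_self n)
  suffices hb : ∃ D, ∀ᶠ n in atTop, V n ≤ D by
    obtain ⟨D, hD⟩ := hb
    obtain ⟨D', hD'⟩ : BddAbove (range V) :=
      IsBoundedUnder.bddAbove_range (f := V) ⟨D, eventually_map.2 hD⟩
    refine ⟨2 * D' + C, fun n => ?_⟩
    obtain ⟨μ, ν, h1, h2, h3, h4, h5⟩ := happ n
    have h6 := hD' (mem_range_self n)
    have h7 := hC' n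
    exact ⟨μ, ν, h1, h2, by linarith, by linarith, h5⟩
  by_contra! hcon
  obtain ⟨φ, hφ, hφV⟩ := extraction_forall_of_frequently
    (P := fun k n => max ε (k + 1 : ℝ) ≤ V n) fun k => (hcon _).mono fun n hn => hn.le
  choose A hA2 hAs hAi using fun k => hwit (φ k) ((le_max_left _ _).trans (hφV k))
  have hτ : TauConv A (toIntegrator 0) := by
    refine ⟨?_, (iSup_le hA2).trans_lt ENNReal.ofNat_lt_top⟩
    rw [Metric.tendstoUniformly_iff]
    intro δ hδ
    have hlim : Tendsto (fun k : ℕ => 2 * ε * (1 / ((k : ℝ) + 1))) atTop (𝓝 0) := by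
      simpa using (tendsto_one_div_add_atTop_nhds_zero_nat (𝕜 := ℝ)).const_mul (2 * ε)
    filter_upwards [hlim.eventually_lt_const hδ] with k hk s
    have h0 : (toIntegrator (0 : integratorSubmodule T)).1 s = 0 := rfl
    rw [h0, dist_zero_left, Real.norm_eq_abs]
    refine ((hAs k s).trans ?_).trans_lt hk
    rw [mul_one_div]
    exact div_le_div_of_nonneg_left (by positivity) (by positivity)
      ((le_max_right _ _).trans (hφV k))
  have h1 := (tendsto_biSup_ofReal_iff.1 (h.2 _ hτ.isRelTauCompact_range)) (ε / 16)
    (by positivity)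
  have h2 := (sConv_const x₀).tendsto_integral hτ
  have h0 : (toIntegrator (0 : integratorSubmodule T)).integral x₀.1 = 0 := by
    rw [← integralBilin_apply, map_zero, LinearMap.zero_apply]
  rw [h0] at h2
  obtain ⟨k, hk1, hk2⟩ := ((hφ.tendsto_atTop.eventually h1).and
    (h2.eventually_lt_const (show 0 < ε / 16 by positivity))).exists
  have h3 := (abs_le.1 (hk1 (A k) (mem_range_self k))).2
  rw [Integrator.integral_sub] at h3
  linarith [hAi k]

end Bounded

/-! ### Weak compactness of sets of finite measures -/

section Compactness

lemma continuous_integral_continuousMap {X : Type*} [TopologicalSpace X] [CompactSpace X]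
    [MeasurableSpace X] [OpensMeasurableSpace X] (μ : Measure X) [IsFiniteMeasure μ] :
    Continuous fun f : C(X, ℝ) => ∫ t, f t ∂μ := by
  have hi : ∀ f : C(X, ℝ), Integrable f μ := fun f =>
    Integrable.of_bound f.continuous.aestronglyMeasurable ‖f‖
      (Eventually.of_forall f.norm_coe_le_norm)
  refine (LipschitzWith.of_dist_le_mul (K := (μ univ).toNNReal) fun f g => ?_).continuous
  rw [dist_eq_norm, dist_eq_norm, ← integral_sub (hi f) (hi g), mul_comm]
  exact norm_integral_le_of_norm_le_const (Eventually.of_forall (f - g).norm_coe_le_norm)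

/-- On a compact metrizable space, the finite measures of mass at most `C` form a sequentially
compact set: it is compact, and the integrals of a dense sequence of test functions embed it into
`ℕ → ℝ`. -/
lemma compactSpace_and_firstCountableTopology_finiteMeasure {X : Type*} [TopologicalSpace X]
    [CompactSpace X] [TopologicalSpace.MetrizableSpace X] [MeasurableSpace X] [BorelSpace X]
    (C : NNReal) :
    CompactSpace {μ : FiniteMeasure X | μ.mass ≤ C} ∧
      FirstCountableTopology {μ : FiniteMeasure X | μ.mass ≤ C} := by
  let := TopologicalSpace.metrizableSpaceMetric X
  have hc : CompactSpace {μ : FiniteMeasure X | μ.mass ≤ C} :=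
    isCompact_iff_compactSpace.1 (isCompact_setOfPred_finiteMeasure_le_of_compactSpace X C)
  refine ⟨hc, ?_⟩
  obtain ⟨f, hf⟩ := TopologicalSpace.exists_dense_seq C(X, ℝ)
  let Φ : {μ : FiniteMeasure X | μ.mass ≤ C} → ℕ → ℝ := fun μ n => ∫ t, f n t ∂(μ.1 : Measure X)
  have hΦ : Continuous Φ := continuous_pi fun n =>
    (FiniteMeasure.continuous_integral_continuousMap (f n)).comp continuous_subtype_val
  have hinj : Function.Injective Φ := by
    intro μ ν hμν
    have h1 := hf.equalizer (continuous_integral_continuousMap (μ.1 : Measure X))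
      (continuous_integral_continuousMap (ν.1 : Measure X)) hμν
    refine Subtype.ext (FiniteMeasure.ext_of_forall_integral_eq fun g => ?_)
    exact congrFun h1 g.toContinuousMap
  exact (hΦ.isClosedEmbedding hinj).isEmbedding.firstCountableTopology

end Compactness

/-! ### Extraction of `S`-convergent subsequences -/

section Converse

variable {T : ℝ} [Fact (0 < T)]

lemma SigmaConv.comp {x : ℕ → Skorokhod T} {x₀ : Skorokhod T} (h : SigmaConv x x₀) {φ : ℕ → ℕ}
    (hφ : Tendsto φ atTop atTop) : SigmaConv (x ∘ φ) x₀ :=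
  ⟨h.1.comp hφ, fun 𝒜 h𝒜 => (h.2 𝒜 h𝒜).comp hφ⟩

lemma SigmaConv.tendsto_integral {x : ℕ → Skorokhod T} {x₀ : Skorokhod T} (h : SigmaConv x x₀)
    (A : Integrator T) : Tendsto (fun n => A.integral (x n).1) atTop (𝓝 (A.integral x₀.1)) := by
  rw [Metric.tendsto_atTop]
  intro ε hε
  have h1 := tendsto_biSup_ofReal_iff.1 (h.2 _ (tauConv_const A).isRelTauCompact_range) (ε / 2)
    (by positivity)
  obtain ⟨N, hN⟩ := eventually_atTop.1 h1
  refine ⟨N, fun n hn => ?_⟩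
  have h2 := hN n hn A ⟨0, rfl⟩
  rw [Integrator.integral_sub] at h2
  rw [Real.dist_eq]
  linarith

/-- Uniform proximity passes to the limit, although neither convergence implies pointwise
convergence: at `t < T` it is tested by averages over short intervals to the right of `t`. -/
lemma SigmaConv.abs_sub_le {x : ℕ → Skorokhod T} {x₀ : Skorokhod T} (h : SigmaConv x x₀)
    {v : ℕ → SkorokhodBV T} {v₀ : SkorokhodBV T} (hv : SkorokhodBV.WeakStarConv v v₀) {ε : ℝ}
    (hε : 0 ≤ ε) (hxv : ∀ n t, |(x n).1 t - (v n).1.1 t| ≤ ε) (t : TimeInterval T) :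
    |x₀.1 t - v₀.1.1 t| ≤ ε := by
  rcases (isTop_right T t).eq_or_lt with rfl | ht
  · exact le_of_tendsto (h.1.sub hv.tendsto_right).abs (Eventually.of_forall fun n => hxv n _)
  · refine le_of_forall_pos_le_add fun η hη => ?_
    have hc : ∀ y : Skorokhod T, ∀ᶠ s in 𝓝[≥] t, |y.1 s - y.1 t| < η / 2 := fun y => by
      have h1 : ContinuousWithinAt (fun s => |y.1 s - y.1 t|) (Ici t) t :=
        ((y.2.1 t).sub continuousWithinAt_const).abs
      exact h1.eventually_lt_const (by simpa using hη)
    obtain ⟨u, hu, hu'⟩ := (mem_nhdsGE_iff_exists_Ico_subset' ht).1 ((hc x₀).and (hc v₀.1))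
    obtain ⟨r, hr1, hr2⟩ := exists_between (show t < u from hu)
    obtain ⟨B, -, -, -, -, hBv, hB⟩ := exists_ramp hr1
    have hmem : ∀ s, t ≤ s → s ≤ r → |x₀.1 s - x₀.1 t| < η / 2 ∧
        |v₀.1.1 s - v₀.1.1 t| < η / 2 := fun s hs hs' => hu' ⟨hs, hs'.trans_lt hr2⟩
    have h1 := abs_le.1 (hB x₀ _ _ fun s hs hs' => (hmem s hs hs').1.le)
    have h2 := abs_le.1 (hB v₀.1 _ _ fun s hs hs' => (hmem s hs hs').2.le)
    have h3 : |integralBilin T B x₀ - integralBilin T B v₀.1| ≤ ε := by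
      refine le_of_tendsto ((h.tendsto_integral (toIntegrator B)).sub
        (hv.tendsto_integral (tauConv_const (toIntegrator B)))).abs
        (Eventually.of_forall fun n => ?_)
      refine ((toIntegrator B).abs_integral_sub_le (hxv n)).trans (mul_le_of_le_one_right hε ?_)
      exact ENNReal.toReal_le_of_le_ofReal zero_le_one (hBv.trans_eq ENNReal.ofReal_one.symm)
    have h4 := abs_le.1 h3
    rw [abs_le]
    constructor <;> linarith

/-- Approximations within `1 / (k + 1)` of bounded variation converge weakly along a subsequence,
simultaneously for all `k`. -/
lemma SigmaConv.exists_subseq_sConv {x : ℕ → Skorokhod T} {x₀ : Skorokhod T}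
    (h : SigmaConv x x₀) : ∃ ψ : ℕ → ℕ, StrictMono ψ ∧ SConv (x ∘ ψ) x₀ := by
  have hpos : ∀ k : ℕ, (0 : ℝ) < 1 / ((k : ℝ) + 1) := fun k => by positivity
  choose K μ ν hμ hν hμK hνK happ using fun k => h.exists_bounded_approx (hpos k)
  let S : ℕ → Set (FiniteMeasure (TimeInterval T)) := fun k => {m | m.mass ≤ (K k).toNNReal}
  have hS : ∀ (k : ℕ) (m : Measure (TimeInterval T)) (hm : IsFiniteMeasure m),
      m.real univ ≤ K k → (⟨m, hm⟩ : FiniteMeasure (TimeInterval T)) ∈ S k := fun k m hm hle => by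
    exact NNReal.le_toNNReal_of_coe_le hle
  have hcs := fun k => compactSpace_and_firstCountableTopology_finiteMeasure
    (X := TimeInterval T) (K k).toNNReal
  have : ∀ k, CompactSpace (S k) := fun k => (hcs k).1
  have : ∀ k, FirstCountableTopology (S k) := fun k => (hcs k).2
  let a : ℕ → ∀ k, S k × S k := fun n k =>
    (⟨_, hS k _ (hμ k n) (hμK k n)⟩, ⟨_, hS k _ (hν k n) (hνK k n)⟩)
  obtain ⟨m, ψ, hψ, hlim⟩ := SeqCompactSpace.tendsto_subseq a
  refine ⟨ψ, hψ, fun ε hε => ?_⟩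
  obtain ⟨k, hk⟩ := exists_nat_one_div_lt hε
  have hlimk : Tendsto (fun n => a (ψ n) k) atTop (𝓝 (m k)) :=
    (tendsto_pi_nhds.1 hlim) k
  have hw : SkorokhodBV.WeakStarConv
      (fun n => SkorokhodBV.ofMeasures (μ k (ψ n)) (ν k (ψ n)))
      (SkorokhodBV.ofMeasures ((m k).1.1 : Measure (TimeInterval T)) (m k).2.1) := by
    intro f
    have hf : Continuous fun p : S k × S k => ∫ t, f t ∂(p.1.1 : Measure (TimeInterval T)) -
        ∫ t, f t ∂(p.2.1 : Measure (TimeInterval T)) :=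
      ((FiniteMeasure.continuous_integral_continuousMap f).comp
        (continuous_subtype_val.comp continuous_fst)).sub
      ((FiniteMeasure.continuous_integral_continuousMap f).comp
        (continuous_subtype_val.comp continuous_snd))
    have h1 := (hf.tendsto (m k)).comp hlimk
    rw [SkorokhodBV.integral_eq_sub _ (fun _ => rfl) f]
    refine h1.congr fun n => ?_
    rw [SkorokhodBV.integral_eq_sub _ (fun _ => rfl) f]
    rfl
  exact ⟨fun n => SkorokhodBV.ofMeasures (μ k (ψ n)) (ν k (ψ n)), _,
    fun n t => (happ k (ψ n) t).trans hk.le, fun t =>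
    ((h.comp hψ.tendsto_atTop).abs_sub_le hw (hpos k).le (fun n => happ k (ψ n)) t).trans hk.le, hw⟩

lemma sStarConv_iff_sigmaConv {x : ℕ → Skorokhod T} {x₀ : Skorokhod T} :
    SStarConv x x₀ ↔ SigmaConv x x₀ :=
  ⟨fun h => h.sigmaConv, fun h _ hφ => (h.comp hφ.tendsto_atTop).exists_subseq_sConv⟩

end Converse

/-! ### The topologies `S` and `Σ` -/

section Topologies

variable {T : ℝ} [Fact (0 < T)]

variable (T) in
lemma withSeminorms_sigmaFamily :
    let := sigmaTopology T
    WithSeminorms (sigmaFamily T) :=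
  let := sigmaTopology T
  ⟨rfl⟩

lemma isLocallyConvexTopology_sigma : IsLocallyConvexTopology (sigmaTopology T) := by
  let := sigmaTopology T
  have h := withSeminorms_sigmaFamily T
  exact ⟨h.topologicalAddGroup, h.continuousSMul, h.toLocallyConvexSpace⟩

lemma tendstoIn_sigma_iff {x : ℕ → Skorokhod T} {x₀ : Skorokhod T} :
    TendstoIn (sigmaTopology T) x x₀ ↔ SigmaConv x x₀ := by
  let := sigmaTopology T
  have h := withSeminorms_sigmaFamily T
  rw [TendstoIn, h.tendsto_nhds, SigmaConv, Option.forall]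
  refine and_congr ?_ (Subtype.forall.trans (forall₂_congr fun 𝒜 h𝒜 => ?_))
  · rw [Metric.tendsto_nhds]
    rfl
  · rw [tendsto_biSup_ofReal_iff]
    constructor
    · intro H ε hε
      filter_upwards [H ε hε] with n hn A hA
      exact (le_ciSup (h𝒜.bddAbove (x n - x₀)) ⟨A, hA⟩).trans hn.le
    · intro H ε hε
      filter_upwards [H (ε / 2) (by positivity)] with n hn
      refine lt_of_le_of_lt ?_ (half_lt_self hε)
      exact Real.iSup_le (fun A => hn A.1 A.2) (by positivity)

lemma sTopology_le_sigmaTopology : sTopology T ≤ sigmaTopology T := by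
  intro U hU y y₀ hy h hy₀
  have h1 : ∀ᶠ n in atTop, y n ∈ U := by
    have h2 := tendstoIn_sigma_iff.2 h.sigmaConv
    let := sigmaTopology T
    exact h2.eventually_mem (hU.mem_nhds hy₀)
  obtain ⟨n, hn⟩ := h1.exists
  exact hy n hn

lemma SStarConv.tendstoIn_sTopology {x : ℕ → Skorokhod T} {x₀ : Skorokhod T}
    (h : SStarConv x x₀) : TendstoIn (sTopology T) x x₀ := by
  let := sTopology T
  refine tendsto_nhds.2 fun U hU hx₀ => ?_
  by_contra hcon
  obtain ⟨φ, hφ, hφU⟩ := extraction_of_frequently_atTop (not_eventually.1 hcon)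
  obtain ⟨ψ, -, hψ⟩ := h φ hφ
  exact hU _ _ (fun n => hφU (ψ n)) hψ hx₀

lemma sStarConv_iff_tendstoIn_sTopology {x : ℕ → Skorokhod T} {x₀ : Skorokhod T} :
    SStarConv x x₀ ↔ TendstoIn (sTopology T) x x₀ :=
  ⟨fun h => h.tendstoIn_sTopology, fun h => sStarConv_iff_sigmaConv.2 <| tendstoIn_sigma_iff.1 <|
    h.mono_right (nhds_mono sTopology_le_sigmaTopology)⟩

end Topologies

end

theorem mainTheorem2 (T : ℝ) [Fact (0 < T)] :
    (∀ (x : ℕ → Skorokhod T) (x₀ : Skorokhod T),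
      (SStarConv x x₀ ↔
        Tendsto (fun n => (x n).1 (TimeInterval.right T)) atTop (𝓝 (x₀.1 (TimeInterval.right T))) ∧
          ∀ 𝒜 : Set (Integrator T), IsRelTauCompact 𝒜 →
            Tendsto (fun n => ⨆ A ∈ 𝒜, ENNReal.ofReal |A.integral (x n - x₀).1|) atTop (𝓝 0)) ∧
      (SStarConv x x₀ ↔ TendstoIn (sTopology T) x x₀) ∧
      (SStarConv x x₀ ↔ TendstoIn (sigmaTopology T) x x₀)) ∧
    IsLocallyConvexTopology (sigmaTopology T) ∧
    -- `S` is finer than `Σ`: every `Σ`-open set is `S`-open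
    sTopology T ≤ sigmaTopology T :=
  ⟨fun _ _ => ⟨sStarConv_iff_sigmaConv, sStarConv_iff_tendstoIn_sTopology,
    sStarConv_iff_sigmaConv.trans tendstoIn_sigma_iff.symm⟩,
    isLocallyConvexTopology_sigma, sTopology_le_sigmaTopology⟩
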